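/- A (bivariate) copula is a function $C:[0,1]^2\to[0,1]$ with $C(0,v)=C(u,0)=0$, $C(1,v)=v$, $C(u,1)=u$ and $C(u_2,v_2)-C(u_1,v_2)-C(u_2,v_1)+C(u_1,v_1)\ge 0$ whenever $u_1\le u_2$, $v_1\le v_2$. Put $W(u,v)=\max\{0,u+v-1\}$, $M(u,v)=\min\{u,v\}$, $\Pi(u,v)=uv$. For copulas $C_1,C_2$ let $$\mathcal Q(C_1,C_2)=4\int_{[0,1]^2}C_2(u,v)\,dC_1(u,v)-1,$$ where $dC_1$ is the probability measure on $[0,1]^2$ with distribution function $C_1$, and define Spearman's rho $\rho(C)=3\mathcal Q(C,\Pi)$, Kendall's tau $\tau(C)=\mathcal Q(C,C)$, Spearman's footrule $\phi(C)=\tfrac12(3\mathcal Q(C,M)-1)$, Gini's gamma $\gamma(C)=\mathcal Q(C,M)+\mathcal Q(C,W)$ and Blomqvist's beta $\beta(C)=4C(\tfrac12,\tfrac12)-1$. Let $m\in[0,\tfrac13]$, let $R=(m,2m)$, $U=(\tfrac{1-m}2,\tfrac{1+m}2)$, $T=(m,1-m)$, and let $\Delta_m$ be the (closed) triangle with vertices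 $R,U,T$. For $(a,b)\in\Delta_m$ let $d_1=W(a,b)+m$, $d_2=M(a,b)-m$ and $$\underline C^{(a,b)}_m(u,v)=\max\{W(u,v),\min\{d_1,u-a+d_1,v-b+d_1,u+v-a-b+d_1\}\},$$ $$\overline C^{(a,b)}_m(u,v)=\min\{M(u,v),\max\{d_2,u-b+d_2,v-a+d_2,u+v-a-b+d_2\}\}.$$ These functions are copulas, and the following holds. 1. For every $\kappa\in\{\rho,\tau,\phi,\gamma,\beta\}$ the maximum of $\kappa(\overline C^{(a,b)}_m)$ over $(a,b)\in\Delta_m$ is attained at $R$. 2. For every $\kappa\in\{\rho,\tau,\phi,\gamma,\beta\}$ the minimum of $\kappa(\underline C^{(a,b)}_m)$ over $(a,b)\in\Delta_m$ is attained at $T$. 3. Every point of the set listed in the following table is a minimizer of $\kappa(\underline C^{(a,b)}_m)$ over $\Delta_m$ (row $\min$), respectively a maximizer of $\kappa(\overline C^{(a,b)}_m)$ over $\Delta_m$ (row $\max$): $$\begin{array}{c|ccccc} & \rho & \tau & \phi & \gamma & \beta\\ \hline \min & UT & UT & T & T & T\\ \max & RU & RU & RU & R & R\end{array}$$ Moreover,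 for $m\in[0,\tfrac13]$, the listed set is the full set of minimizers, respectively maximizers, if and only if: $m>0$ (row $\min$ for $\rho,\tau$; row $\max$ for $\rho,\tau,\phi$); $m\ge\tfrac14$ (row $\min$ for $\phi,\gamma,\beta$); $m\ge\tfrac16$ (row $\max$ for $\gamma$); $\tfrac16\le m<\tfrac14$ or $m=\tfrac13$ (row $\max$ for $\beta$). -/

import Mathlib

open Set MeasureTheory

noncomputable section

namespace CopulaAsymmetry

/-- A bivariate copula, given by a real function of which only the values on the unit square
`[0,1]²` matter: it is grounded, has uniform margins and is 2-increasing. -/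
structure IsCopula (C : ℝ → ℝ → ℝ) : Prop where
  zero_left : ∀ v ∈ Icc (0 : ℝ) 1, C 0 v = 0
  zero_right : ∀ u ∈ Icc (0 : ℝ) 1, C u 0 = 0
  one_left : ∀ v ∈ Icc (0 : ℝ) 1, C 1 v = v
  one_right : ∀ u ∈ Icc (0 : ℝ) 1, C u 1 = u
  two_increasing : ∀ u₁ ∈ Icc (0 : ℝ) 1, ∀ u₂ ∈ Icc (0 : ℝ) 1,
    ∀ v₁ ∈ Icc (0 : ℝ) 1, ∀ v₂ ∈ Icc (0 : ℝ) 1, u₁ ≤ u₂ → v₁ ≤ v₂ →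
      0 ≤ C u₂ v₂ - C u₁ v₂ - C u₂ v₁ + C u₁ v₁

/-- The lower Fréchet–Hoeffding bound `W(u,v) = max{0, u+v-1}`. -/
def copW (u v : ℝ) : ℝ := max 0 (u + v - 1)

/-- The upper Fréchet–Hoeffding bound `M(u,v) = min{u,v}`. -/
def copM (u v : ℝ) : ℝ := min u v

/-- The independence copula `Π(u,v) = uv`. -/
def copPi (u v : ℝ) : ℝ := u * v

/-- The lower local bound: with `d₁ = W(a,b) + c`,
`max{W(u,v), min{d₁, u-a+d₁, v-b+d₁, u+v-a-b+d₁}}`. -/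
def lowerBound (a b c : ℝ) (u v : ℝ) : ℝ :=
  let d₁ := copW a b + c
  max (copW u v) (min (min d₁ (u - a + d₁)) (min (v - b + d₁) (u + v - a - b + d₁)))

/-- The upper local bound: with `d₂ = M(a,b) - c`,
`min{M(u,v), max{d₂, u-b+d₂, v-a+d₂, u+v-a-b+d₂}}`. -/
def upperBound (a b c : ℝ) (u v : ℝ) : ℝ :=
  let d₂ := copM a b - c
  min (copM u v) (max (max d₂ (u - b + d₂)) (max (v - a + d₂) (u + v - a - b + d₂)))

/-- `μ` is the probability distribution on the plane whose joint distribution function is `C`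
on the unit square. -/
structure IsInducedMeasure (C : ℝ → ℝ → ℝ) (μ : Measure (ℝ × ℝ)) : Prop where
  prob : IsProbabilityMeasure μ
  cdf : ∀ u ∈ Icc (0 : ℝ) 1, ∀ v ∈ Icc (0 : ℝ) 1,
    μ (Iic u ×ˢ Iic v) = ENNReal.ofReal (C u v)

/-- A copula has at most one induced distribution. -/
theorem IsInducedMeasure.unique {C : ℝ → ℝ → ℝ} (hC : IsCopula C) {μ ν : Measure (ℝ × ℝ)}
    (hμ : IsInducedMeasure C μ) (hν : IsInducedMeasure C ν) : μ = ν := by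
  have key : ∀ ρ : Measure (ℝ × ℝ), IsInducedMeasure C ρ → ∀ u v : ℝ,
      ρ (Iic u ×ˢ Iic v) = if u < 0 ∨ v < 0 then 0
        else ENNReal.ofReal (C (min u 1) (min v 1)) := by
    intro ρ hρ u v
    have := hρ.prob
    have h1 : (1 : ℝ) ∈ Icc (0 : ℝ) 1 := ⟨zero_le_one, le_rfl⟩
    have h0 : (0 : ℝ) ∈ Icc (0 : ℝ) 1 := ⟨le_rfl, zero_le_one⟩
    have hfull : ρ (Iic 1 ×ˢ Iic 1) = 1 := by
      rw [hρ.cdf 1 h1 1 h1, hC.one_left 1 h1, ENNReal.ofReal_one]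
    have hae : ∀ᵐ p ∂ρ, p ∈ (Iic (1 : ℝ) ×ˢ Iic (1 : ℝ)) := by
      rw [ae_iff]
      exact (prob_compl_eq_zero_iff (measurableSet_Iic.prod measurableSet_Iic)).2 hfull
    have hmin : ρ (Iic u ×ˢ Iic v) = ρ (Iic (min u 1) ×ˢ Iic (min v 1)) := by
      apply measure_congr
      filter_upwards [hae] with p hp
      apply propext
      change (p.1 ≤ u ∧ p.2 ≤ v) ↔ (p.1 ≤ min u 1 ∧ p.2 ≤ min v 1)
      have h2 : p.1 ≤ 1 := hp.1
      have h3 : p.2 ≤ 1 := hp.2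
      simp [h2, h3]
    split_ifs with h
    · rw [hmin]
      rcases h with h | h
      · refine measure_mono_null (t := Iic 0 ×ˢ Iic 1) ?_ ?_
        · exact prod_mono (Iic_subset_Iic.2 ((min_le_left _ _).trans h.le))
            (Iic_subset_Iic.2 (min_le_right _ _))
        · rw [hρ.cdf 0 h0 1 h1, hC.zero_left 1 h1, ENNReal.ofReal_zero]
      · refine measure_mono_null (t := Iic 1 ×ˢ Iic 0) ?_ ?_
        · exact prod_mono (Iic_subset_Iic.2 (min_le_right _ _))
            (Iic_subset_Iic.2 ((min_le_left _ _).trans h.le))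
        · rw [hρ.cdf 1 h1 0 h0, hC.zero_right 1 h1, ENNReal.ofReal_zero]
    · push Not at h
      rw [hmin, hρ.cdf _ ⟨le_min h.1 zero_le_one, min_le_right _ _⟩ _
        ⟨le_min h.2 zero_le_one, min_le_right _ _⟩]
  have := hμ.prob
  have := hν.prob
  have hspan : IsCountablySpanning (range (Iic : ℝ → Set ℝ)) :=
    ⟨fun n : ℕ => Iic (n : ℝ), fun n => ⟨n, rfl⟩, by
      ext x
      simpa using exists_nat_ge x⟩
  refine ext_of_generate_finite _
    (generateFrom_eq_prod (borel_eq_generateFrom_Iic ℝ).symm (borel_eq_generateFrom_Iic ℝ).symm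
      hspan hspan).symm
    (isPiSystem_Iic.prod isPiSystem_Iic) ?_ (by simp)
  rintro _ ⟨_, ⟨u, rfl⟩, _, ⟨v, rfl⟩, rfl⟩
  rw [key μ hμ, key ν hν]

open Classical in
/-- The measure `dC` induced by a copula `C` (the zero measure if no distribution on the plane
has distribution function `C`, which does not happen for a copula). -/
def inducedMeasure (C : ℝ → ℝ → ℝ) : Measure (ℝ × ℝ) :=
  if h : ∃ μ, IsInducedMeasure C μ then h.choose else 0

/-- The concordance function `𝒬(C₁,C₂) = 4 ∫_{[0,1]²} C₂(u,v) dC₁(u,v) - 1`. -/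
def concordance (C₁ C₂ : ℝ → ℝ → ℝ) : ℝ :=
  4 * (∫ p in Icc (0 : ℝ) 1 ×ˢ Icc (0 : ℝ) 1, C₂ p.1 p.2 ∂(inducedMeasure C₁)) - 1

/-- Names of the five measures of concordance: Spearman's rho, Kendall's tau,
Spearman's footrule, Gini's gamma, Blomqvist's beta. -/
inductive Kappa : Type
  | rho | tau | phi | gamma | beta

/-- The value of a measure of concordance on a copula. -/
def Kappa.eval : Kappa → (ℝ → ℝ → ℝ) → ℝ
  | .rho, C => 3 * concordance C copPi
  | .tau, C => concordance C C
  | .phi, C => (3 * concordance C copM - 1) / 2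
  | .gamma, C => concordance C copM + concordance C copW
  | .beta, C => 4 * C (1 / 2) (1 / 2) - 1

/-- The vertex `R(m, 2m)`. -/
def vertexR (m : ℝ) : ℝ × ℝ := (m, 2 * m)

/-- The vertex `U((1-m)/2, (1+m)/2)`. -/
def vertexU (m : ℝ) : ℝ × ℝ := ((1 - m) / 2, (1 + m) / 2)

/-- The vertex `T(m, 1-m)`. -/
def vertexT (m : ℝ) : ℝ × ℝ := (m, 1 - m)

/-- The triangle `Δ_m` with vertices `R`, `U`, `T`. -/
def triangle (m : ℝ) : Set (ℝ × ℝ) := convexHull ℝ {vertexR m, vertexU m, vertexT m}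

/-- The points of `Δ_m` at which `(a,b) ↦ κ(lower local bound)` attains its minimum over `Δ_m`. -/
def minimizers (κ : Kappa) (m : ℝ) : Set (ℝ × ℝ) :=
  {p ∈ triangle m | IsMinOn (fun q => κ.eval (lowerBound q.1 q.2 m)) (triangle m) p}

/-- The points of `Δ_m` at which `(a,b) ↦ κ(upper local bound)` attains its maximum over `Δ_m`. -/
def maximizers (κ : Kappa) (m : ℝ) : Set (ℝ × ℝ) :=
  {p ∈ triangle m | IsMaxOn (fun q => κ.eval (upperBound q.1 q.2 m)) (triangle m) p}

/-- The row `min` of the table. -/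
def minTable (m : ℝ) : Kappa → Set (ℝ × ℝ)
  | .rho => segment ℝ (vertexU m) (vertexT m)
  | .tau => segment ℝ (vertexU m) (vertexT m)
  | .phi => {vertexT m}
  | .gamma => {vertexT m}
  | .beta => {vertexT m}

/-- The row `max` of the table. -/
def maxTable (m : ℝ) : Kappa → Set (ℝ × ℝ)
  | .rho => segment ℝ (vertexR m) (vertexU m)
  | .tau => segment ℝ (vertexR m) (vertexU m)
  | .phi => segment ℝ (vertexR m) (vertexU m)
  | .gamma => {vertexR m}
  | .beta => {vertexR m}

/-- The values of `m` for which the entry of the row `min` is the whole set of minimizers. -/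
def minExact : Kappa → Set ℝ
  | .rho => Ioc 0 (1 / 3)
  | .tau => Ioc 0 (1 / 3)
  | .phi => Icc (1 / 4) (1 / 3)
  | .gamma => Icc (1 / 4) (1 / 3)
  | .beta => Icc (1 / 4) (1 / 3)

/-- The values of `m` for which the entry of the row `max` is the whole set of maximizers. -/
def maxExact : Kappa → Set ℝ
  | .rho => Ioc 0 (1 / 3)
  | .tau => Ioc 0 (1 / 3)
  | .phi => Ioc 0 (1 / 3)
  | .gamma => Icc (1 / 6) (1 / 3)
  | .beta => Ico (1 / 6) (1 / 4) ∪ {1 / 3}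

end CopulaAsymmetry

end

noncomputable section

namespace CopulaAsymmetry

/-! On the triangle both local bounds come from one family. The greatest copula `upperForm p q d`
with value `d` at `(p, q)` is a shuffle of `M`: its mass lies on four segments of slope one, the two
middle ones being exchanged. The upper bound at `(a, b)` is `upperForm b a (a - m)`, and the lower
bound is the reflection in the second variable of `upperForm a (1 - b) (a - m)`. The induced
measures are therefore explicit, and `IsInducedMeasure.unique` lets them replace the chosen one in
`concordance`.

Integration over the segments gives closed forms in `p - d` and `q - d`. One of these always equals
`m`; the other is `b - a + m` for the upper bound and `1 - a - b + m` for the lower. So `ρ` and `τ`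
of both bounds, and `φ` of the upper one, depend only on the distance to the edge `RU` (where `b = a
+ m`) or `UT` (where `a + b = 1`), strictly so when `m > 0`.

The remaining cases need the integral of the copula along the diagonal or the antidiagonal
(`IsInducedMeasure.integral_copM`, `IsInducedMeasure.integral_copW`), or its value at the centre.
These sections are pointwise monotone towards `T`, respectively pointwise largest at `R`, which
settles optimality. The thresholds for exactness mark where the constraint at the prescribed point
stops affecting the section: below `1/4` the section for `T` already coincides with that of `W`, and
below `1/6` some point of `RU` other than `R` has the section of `M`. For `β` of the upper bound the
constraint is moreover saturated at the centre from `m = 1/4` on, so all points tie. -/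

/-! ### Shuffles of the Fréchet–Hoeffding bounds -/

/-- The greatest copula with value `d` at `(p, q)`. -/
def upperForm (p q d u v : ℝ) : ℝ := min (min u v) (d + max 0 (u - p) + max 0 (v - q))

/-- The length of the set of `x ∈ (p, q]` with `x ≤ w`. -/
def clip (p q w : ℝ) : ℝ := max 0 (min q w - p)

theorem clip_mono (p q : ℝ) : Monotone (clip p q) := fun _ _ h => by
  unfold clip; gcongr

theorem clip_nonneg (p q w : ℝ) : 0 ≤ clip p q w := le_max_left _ _

/-- For monotone `h`, `h (min u w)` behaves like the distribution function of a mass on the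
diagonal. Applied to `clip` with `w = v - c`, it handles each segment of a shuffle separately. -/
theorem two_increasing_of_monotone {h : ℝ → ℝ} (hh : Monotone h) {u₁ u₂ w₁ w₂ : ℝ}
    (hu : u₁ ≤ u₂) (hw : w₁ ≤ w₂) :
    0 ≤ h (min u₂ w₂) - h (min u₁ w₂) - h (min u₂ w₁) + h (min u₁ w₁) := by
  rcases le_total u₁ w₁ with h1 | h1
  · rw [min_eq_left h1, min_eq_left (h1.trans hw)]
    linarith [hh (min_le_min_left u₂ hw)]
  · rw [min_eq_right h1, min_eq_right (h1.trans hu)]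
    linarith [hh (min_le_min_right w₂ hu)]

/-- Admissible parameters of `upperForm`. -/
structure Admissible (p q d : ℝ) : Prop where
  nonneg : 0 ≤ d
  le_left : d ≤ p
  le_right : d ≤ q
  add_le : p + q - d ≤ 1

/-- Each summand is the mass that one of the four segments gives to the quadrant below `(u, v)`.
This decomposition yields both the copula property and the induced measure. -/
theorem clip_sum {p q d : ℝ} (h : Admissible p q d) {u v : ℝ} (hu : u ∈ Icc (0 : ℝ) 1)
    (hv : v ∈ Icc (0 : ℝ) 1) :
    clip 0 d (min u v) + clip d p (min u (v - (q - d))) +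
      clip p (p + q - d) (min u (v - (d - p))) + clip (p + q - d) 1 (min u v) =
    upperForm p q d u v := by
  obtain ⟨h1, h2, h3, h4⟩ := h
  obtain ⟨hu0, hu1⟩ := hu
  obtain ⟨hv0, hv1⟩ := hv
  unfold upperForm
  rcases le_total u d with a1 | a1 <;> rcases le_total v d with b1 | b1 <;>
    rcases le_total u p with a2 | a2 <;> rcases le_total v q with b2 | b2 <;>
    rcases le_total u (p + q - d) with a3 | a3 <;>
    rcases le_total v (p + q - d) with b3 | b3 <;>
    grind (splits := 30) [clip]

/-- The length measure on the graph of `g` over `(p, q]`. -/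
def graphMeasure (p q : ℝ) (g : ℝ → ℝ) : Measure (ℝ × ℝ) :=
  (volume.restrict (Ioc p q)).map fun x => (x, g x)

theorem graphMeasure_apply {p q : ℝ} {g : ℝ → ℝ} (hg : Continuous g) (u v : ℝ) :
    graphMeasure p q g (Iic u ×ˢ Iic v) = volume (Ioc p q ∩ {x | x ≤ u ∧ g x ≤ v}) := by
  have hm : MeasurableSet {x | x ≤ u ∧ g x ≤ v} :=
    (measurableSet_le measurable_id measurable_const).inter
      (measurableSet_le hg.measurable measurable_const)
  rw [graphMeasure, Measure.map_apply (by fun_prop) (measurableSet_Iic.prod measurableSet_Iic),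
    Measure.restrict_apply' measurableSet_Ioc, inter_comm]
  rfl

theorem graphMeasure_add_apply {p q : ℝ} (c u v : ℝ) :
    graphMeasure p q (fun x => x + c) (Iic u ×ˢ Iic v) =
      ENNReal.ofReal (clip p q (min u (v - c))) := by
  rw [graphMeasure_apply (by fun_prop)]
  have : Ioc p q ∩ {x | x ≤ u ∧ x + c ≤ v} = Ioc p (min q (min u (v - c))) := by
    ext x
    simp only [mem_inter_iff, mem_Ioc, mem_ofPred_eq, le_min_iff, le_sub_iff_add_le]
    tauto
  rw [this, Real.volume_Ioc, clip, ENNReal.ofReal_max]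
  simp

theorem graphMeasure_sub_apply {p q : ℝ} (c u v : ℝ) :
    graphMeasure p q (fun x => 1 - (x + c)) (Iic u ×ˢ Iic v) =
      ENNReal.ofReal (clip p q u - clip p q (min u (1 - v - c))) := by
  rw [graphMeasure_apply (by fun_prop)]
  have h1 : clip p q u - clip p q (min u (1 - v - c)) =
      max 0 (min q u - max p (1 - v - c)) := by
    grind [clip]
  have h2 : volume (Ioc p q ∩ {x | x ≤ u ∧ 1 - (x + c) ≤ v}) =
      volume (Ioc (max p (1 - v - c)) (min q u)) := by
    apply measure_congr
    -- A decreasing graph meets the quadrant in a set closed on the left; discarding this one point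
    -- gives a half-open interval.
    have : ∀ᵐ x : ℝ, x ≠ 1 - v - c := by simp [ae_iff]
    filter_upwards [this] with x hx
    apply propext
    change (x ∈ Ioc p q ∧ (x ≤ u ∧ 1 - (x + c) ≤ v)) ↔ (_ < x ∧ _ ≤ _)
    rw [max_lt_iff, le_min_iff]
    constructor
    · rintro ⟨⟨h1, h2⟩, h3, h4⟩
      exact ⟨⟨h1, lt_of_le_of_ne (by linarith) hx.symm⟩, h2, h3⟩
    · rintro ⟨⟨h1, h2⟩, h3, h4⟩
      exact ⟨⟨h1, h3⟩, h4, by linarith⟩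
  rw [h1, h2, Real.volume_Ioc, ENNReal.ofReal_max]
  simp

theorem continuous_integrable_graphMeasure {p q : ℝ} {g : ℝ → ℝ} (hg : Continuous g)
    {G : ℝ × ℝ → ℝ} (hG : Continuous G) : Integrable G (graphMeasure p q g) := by
  rw [graphMeasure, integrable_map_measure hG.aestronglyMeasurable (by fun_prop)]
  exact (Continuous.integrableOn_Ioc (f := G ∘ fun x => (x, g x)) (by fun_prop))

theorem integral_graphMeasure {p q : ℝ} (hpq : p ≤ q) {g : ℝ → ℝ} (hg : Continuous g)
    {G : ℝ × ℝ → ℝ} (hG : Continuous G) :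
    ∫ z, G z ∂(graphMeasure p q g) = ∫ x in p..q, G (x, g x) := by
  rw [graphMeasure, integral_map (by fun_prop) hG.aestronglyMeasurable,
    intervalIntegral.integral_of_le hpq]

/-- The measure with mass on the image under `g` of the four segments that carry the copula
`upperForm p q d`. -/
def shuffle (p q d : ℝ) (g : ℝ → ℝ) : Measure (ℝ × ℝ) :=
  graphMeasure 0 d (fun x => g (x + 0)) + graphMeasure d p (fun x => g (x + (q - d))) +
    graphMeasure p (p + q - d) (fun x => g (x + (d - p))) +
    graphMeasure (p + q - d) 1 (fun x => g (x + 0))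

theorem integral_shuffle {p q d : ℝ} (h : Admissible p q d) {g : ℝ → ℝ} (hg : Continuous g)
    {G : ℝ × ℝ → ℝ} (hG : Continuous G) :
    ∫ z, G z ∂(shuffle p q d g) = (∫ x in (0 : ℝ)..d, G (x, g x)) +
      (∫ x in d..p, G (x, g (x + (q - d)))) +
      (∫ x in p..(p + q - d), G (x, g (x + (d - p)))) + ∫ x in (p + q - d)..1, G (x, g x) := by
  obtain ⟨h1, h2, h3, h4⟩ := h
  have i1 : ∀ p q c : ℝ, Integrable G (graphMeasure p q (fun x => g (x + c))) := fun p q c =>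
    continuous_integrable_graphMeasure (by fun_prop) hG
  rw [shuffle, integral_add_measure (((i1 _ _ _).add_measure (i1 _ _ _)).add_measure (i1 _ _ _))
      (i1 _ _ _), integral_add_measure ((i1 _ _ _).add_measure (i1 _ _ _)) (i1 _ _ _),
    integral_add_measure (i1 _ _ _) (i1 _ _ _),
    integral_graphMeasure h1 (by fun_prop) hG, integral_graphMeasure h2 (by fun_prop) hG,
    integral_graphMeasure (by linarith) (by fun_prop) hG,
    integral_graphMeasure h4 (by fun_prop) hG]
  simp only [add_zero]

/-- The copula `upperForm p q d` reflected in its second variable. -/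
def reflectedForm (p q d u v : ℝ) : ℝ := u - upperForm p q d u (1 - v)

theorem shuffle_id_apply {p q d : ℝ} (h : Admissible p q d) {u v : ℝ} (hu : u ∈ Icc (0 : ℝ) 1)
    (hv : v ∈ Icc (0 : ℝ) 1) :
    shuffle p q d id (Iic u ×ˢ Iic v) = ENNReal.ofReal (upperForm p q d u v) := by
  simp only [shuffle, id, Measure.add_apply, graphMeasure_add_apply, sub_zero]
  rw [← clip_sum h hu hv]
  have := @clip_nonneg
  rw [ENNReal.ofReal_add, ENNReal.ofReal_add, ENNReal.ofReal_add]
  all_goals first | exact this _ _ _ | skip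
  · exact add_nonneg (this _ _ _) (this _ _ _)
  · exact add_nonneg (add_nonneg (this _ _ _) (this _ _ _)) (this _ _ _)

theorem clip_sum_one {p q d : ℝ} (h : Admissible p q d) {u : ℝ} (hu : u ∈ Icc (0 : ℝ) 1) :
    clip 0 d u + clip d p u + clip p (p + q - d) u + clip (p + q - d) 1 u = u := by
  obtain ⟨h1, h2, h3, h4⟩ := h
  obtain ⟨hu0, hu1⟩ := hu
  grind (splits := 30) [clip]

theorem shuffle_sub_apply {p q d : ℝ} (h : Admissible p q d) {u v : ℝ} (hu : u ∈ Icc (0 : ℝ) 1)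
    (hv : v ∈ Icc (0 : ℝ) 1) :
    shuffle p q d (fun y => 1 - y) (Iic u ×ˢ Iic v) =
      ENNReal.ofReal (reflectedForm p q d u v) := by
  have hv' : 1 - v ∈ Icc (0 : ℝ) 1 := ⟨by linarith [hv.2], by linarith [hv.1]⟩
  have key : ∀ p q w : ℝ, 0 ≤ clip p q u - clip p q (min u w) := fun p q w =>
    sub_nonneg.2 (clip_mono p q (min_le_left _ _))
  have h0 := key 0 d (1 - v)
  have h1 := key d p (1 - v - (q - d))
  have h2 := key p (p + q - d) (1 - v - (d - p))
  have h3 := key (p + q - d) 1 (1 - v)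
  simp only [shuffle, Measure.add_apply, graphMeasure_sub_apply, sub_zero]
  rw [← ENNReal.ofReal_add h0 h1, ← ENNReal.ofReal_add (add_nonneg h0 h1) h2,
    ← ENNReal.ofReal_add (add_nonneg (add_nonneg h0 h1) h2) h3, reflectedForm,
    ← clip_sum h hu hv']
  congr 1
  -- The minuends add up to the first margin `u`, the subtrahends to the value of `upperForm` at
  -- `(u, 1 - v)`.
  linarith [clip_sum_one h hu]

theorem isCopula_upperForm {p q d : ℝ} (h : Admissible p q d) : IsCopula (upperForm p q d) where
  zero_left v hv := by obtain ⟨h1, h2, h3, h4⟩ := h; obtain ⟨h5, h6⟩ := hv; grind [upperForm]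
  zero_right v hv := by obtain ⟨h1, h2, h3, h4⟩ := h; obtain ⟨h5, h6⟩ := hv; grind [upperForm]
  one_left v hv := by obtain ⟨h1, h2, h3, h4⟩ := h; obtain ⟨h5, h6⟩ := hv; grind [upperForm]
  one_right v hv := by obtain ⟨h1, h2, h3, h4⟩ := h; obtain ⟨h5, h6⟩ := hv; grind [upperForm]
  two_increasing u₁ hu₁ u₂ hu₂ v₁ hv₁ v₂ hv₂ hu hv := by
    rw [← clip_sum h hu₁ hv₁, ← clip_sum h hu₁ hv₂, ← clip_sum h hu₂ hv₁, ← clip_sum h hu₂ hv₂]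
    have key : ∀ p q c : ℝ, _ := fun p q c =>
      two_increasing_of_monotone (clip_mono p q) hu (sub_le_sub_right hv c)
    have h0 := key 0 d 0
    have h3 := key (p + q - d) 1 0
    rw [sub_zero, sub_zero] at h0 h3
    linarith [key d p (q - d), key p (p + q - d) (d - p)]

theorem isCopula_reflectedForm {p q d : ℝ} (h : Admissible p q d) :
    IsCopula (reflectedForm p q d) := by
  have hC := isCopula_upperForm h
  have hr : ∀ v ∈ Icc (0 : ℝ) 1, 1 - v ∈ Icc (0 : ℝ) 1 := fun v hv =>
    ⟨by linarith [hv.2], by linarith [hv.1]⟩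
  constructor
  · intro v hv
    rw [reflectedForm, hC.zero_left _ (hr v hv), sub_zero]
  · intro u hu
    rw [reflectedForm, sub_zero, hC.one_right u hu, sub_self]
  · intro v hv
    rw [reflectedForm, hC.one_left _ (hr v hv), sub_sub_cancel]
  · intro u hu
    rw [reflectedForm, sub_self, hC.zero_right u hu, sub_zero]
  · intro u₁ hu₁ u₂ hu₂ v₁ hv₁ v₂ hv₂ hu hv
    have := hC.two_increasing u₁ hu₁ u₂ hu₂ _ (hr v₂ hv₂) _ (hr v₁ hv₁) hu (by linarith)
    simp only [reflectedForm]
    linarith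

/-! ### Induced measures and means with respect to them. -/

theorem IsCopula.nonneg {C : ℝ → ℝ → ℝ} (hC : IsCopula C) {u v : ℝ} (hu : u ∈ Icc (0 : ℝ) 1)
    (hv : v ∈ Icc (0 : ℝ) 1) : 0 ≤ C u v := by
  have h0 : (0 : ℝ) ∈ Icc (0 : ℝ) 1 := ⟨le_rfl, zero_le_one⟩
  have := hC.two_increasing 0 h0 u hu 0 h0 v hv hu.1 hv.1
  rw [hC.zero_left v hv, hC.zero_right u hu, hC.zero_left 0 h0] at this
  linarith

theorem isInducedMeasure_of_apply {C : ℝ → ℝ → ℝ} {p q d : ℝ}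
    (h : Admissible p q d) {g : ℝ → ℝ} (hg : Continuous g)
    (hcdf : ∀ u ∈ Icc (0 : ℝ) 1, ∀ v ∈ Icc (0 : ℝ) 1,
      shuffle p q d g (Iic u ×ˢ Iic v) = ENNReal.ofReal (C u v)) :
    IsInducedMeasure C (shuffle p q d g) := by
  refine ⟨⟨?_⟩, hcdf⟩
  obtain ⟨h1, h2, h3, h4⟩ := h
  have key : ∀ p q c : ℝ, graphMeasure p q (fun x => g (x + c)) univ = ENNReal.ofReal (q - p) := by
    intro p q c
    rw [graphMeasure, Measure.map_apply (by fun_prop) MeasurableSet.univ]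
    simp
  simp only [shuffle, Measure.add_apply, key]
  rw [← ENNReal.ofReal_add, ← ENNReal.ofReal_add, ← ENNReal.ofReal_add]
  · rw [← ENNReal.ofReal_one]
    congr 1
    ring
  all_goals linarith

theorem IsInducedMeasure.ae_mem {C : ℝ → ℝ → ℝ} (hC : IsCopula C) {μ : Measure (ℝ × ℝ)}
    (hμ : IsInducedMeasure C μ) : ∀ᵐ z ∂μ, z ∈ Icc (0 : ℝ) 1 ×ˢ Icc (0 : ℝ) 1 := by
  have := hμ.prob
  have h1 : (1 : ℝ) ∈ Icc (0 : ℝ) 1 := ⟨zero_le_one, le_rfl⟩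
  have h0 : (0 : ℝ) ∈ Icc (0 : ℝ) 1 := ⟨le_rfl, zero_le_one⟩
  have e1 : ∀ᵐ z ∂μ, z ∈ Iic (1 : ℝ) ×ˢ Iic (1 : ℝ) := by
    rw [ae_iff]
    refine (prob_compl_eq_zero_iff (measurableSet_Iic.prod measurableSet_Iic)).2 ?_
    rw [hμ.cdf 1 h1 1 h1, hC.one_left 1 h1, ENNReal.ofReal_one]
  have e2 : ∀ᵐ z ∂μ, z ∉ Iic (0 : ℝ) ×ˢ Iic (1 : ℝ) := by
    rw [ae_iff]
    simp only [not_not, ofPred_mem_eq]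
    rw [hμ.cdf 0 h0 1 h1, hC.zero_left 1 h1, ENNReal.ofReal_zero]
  have e3 : ∀ᵐ z ∂μ, z ∉ Iic (1 : ℝ) ×ˢ Iic (0 : ℝ) := by
    rw [ae_iff]
    simp only [not_not, ofPred_mem_eq]
    rw [hμ.cdf 1 h1 0 h0, hC.zero_right 1 h1, ENNReal.ofReal_zero]
  filter_upwards [e1, e2, e3] with z h1 h2 h3
  simp only [mem_prod, mem_Iic, mem_Icc, not_and, not_le] at *
  refine ⟨⟨?_, h1.1⟩, ?_, h1.2⟩
  · by_contra hz
    linarith [h2 (by linarith)]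
  · by_contra hz
    linarith [h3 h1.1]

/-- Uniqueness removes the choice made in `inducedMeasure`, and the restriction to the unit square
disappears because its complement is null. -/
theorem IsInducedMeasure.concordance_eq {C : ℝ → ℝ → ℝ} (hC : IsCopula C) {μ : Measure (ℝ × ℝ)}
    (hμ : IsInducedMeasure C μ) (D : ℝ → ℝ → ℝ) :
    concordance C D = 4 * (∫ z, D z.1 z.2 ∂μ) - 1 := by
  have hex : ∃ μ, IsInducedMeasure C μ := ⟨μ, hμ⟩
  have : inducedMeasure C = μ := by
    rw [inducedMeasure, dif_pos hex]
    exact IsInducedMeasure.unique hC hex.choose_spec hμ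
  rw [concordance, this, Measure.restrict_eq_self_of_ae_mem (hμ.ae_mem hC)]

/-- A double count: the `μ`-mean length of `{t ∈ [0,1] | x ≤ t, y ≤ s t}` is the integral of
the distribution function along `s`. -/
theorem IsInducedMeasure.integral_section {C : ℝ → ℝ → ℝ} (hC : IsCopula C) {μ : Measure (ℝ × ℝ)}
    (hμ : IsInducedMeasure C μ) {r s : ℝ → ℝ} (hr : Continuous r) (hs : Continuous s)
    (hr' : ∀ t ∈ Icc (0 : ℝ) 1, r t ∈ Icc (0 : ℝ) 1)
    (hs' : ∀ t ∈ Icc (0 : ℝ) 1, s t ∈ Icc (0 : ℝ) 1) :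
    ∫ z, volume.real {t | t ∈ Icc (0 : ℝ) 1 ∧ z.1 ≤ r t ∧ z.2 ≤ s t} ∂μ =
      ∫ t in (0 : ℝ)..1, C (r t) (s t) := by
  have := hμ.prob
  set S : Set ((ℝ × ℝ) × ℝ) := {w | w.1.1 ≤ r w.2} ∩ {w | w.1.2 ≤ s w.2} with hS
  have hSm : MeasurableSet S :=
    (measurableSet_le (f := fun w : (ℝ × ℝ) × ℝ => w.1.1) (by fun_prop)
      (hr.measurable.comp measurable_snd)).inter
    (measurableSet_le (f := fun w : (ℝ × ℝ) × ℝ => w.1.2) (by fun_prop)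
      (hs.measurable.comp measurable_snd))
  have hint : Integrable (Function.uncurry fun z t => S.indicator (fun _ => (1 : ℝ)) (z, t))
      (μ.prod (volume.restrict (Icc (0 : ℝ) 1))) :=
    (integrable_const (1 : ℝ)).indicator hSm
  have h := integral_integral_swap hint
  have h1 : ∀ z : ℝ × ℝ, ∫ t in Icc (0 : ℝ) 1, S.indicator (fun _ => (1 : ℝ)) (z, t) =
      volume.real {t | t ∈ Icc (0 : ℝ) 1 ∧ z.1 ≤ r t ∧ z.2 ≤ s t} := by
    intro z
    have hz : MeasurableSet (Prod.mk z ⁻¹' S) := measurable_prodMk_left hSm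
    rw [show (fun t => S.indicator (fun _ => (1 : ℝ)) (z, t)) =
      (Prod.mk z ⁻¹' S).indicator 1 from rfl, integral_indicator_one hz,
      measureReal_restrict_apply hz, inter_comm]
    rfl
  have h2 : ∀ t ∈ Icc (0 : ℝ) 1, ∫ z, S.indicator (fun _ => (1 : ℝ)) (z, t) ∂μ =
      C (r t) (s t) := by
    intro t ht
    have hz : MeasurableSet ((fun z => (z, t)) ⁻¹' S) := measurable_prodMk_right hSm
    rw [show (fun z => S.indicator (fun _ => (1 : ℝ)) (z, t)) =
      ((fun z => (z, t)) ⁻¹' S).indicator 1 from rfl, integral_indicator_one hz,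
      show (fun z => (z, t)) ⁻¹' S = Iic (r t) ×ˢ Iic (s t) from rfl, measureReal_def,
      hμ.cdf _ (hr' t ht) _ (hs' t ht), ENNReal.toReal_ofReal (hC.nonneg (hr' t ht) (hs' t ht))]
  simp only [h1] at h
  rw [h, setIntegral_congr_fun measurableSet_Icc h2, integral_Icc_eq_integral_Ioc,
    intervalIntegral.integral_of_le zero_le_one]

theorem IsInducedMeasure.integrable {C : ℝ → ℝ → ℝ} (hC : IsCopula C) {μ : Measure (ℝ × ℝ)}
    (hμ : IsInducedMeasure C μ) {G : ℝ × ℝ → ℝ} (hG : Continuous G) : Integrable G μ := by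
  have := hμ.prob
  have h := hG.continuousOn.integrableOn_compact (μ := μ)
    ((isCompact_Icc (a := (0 : ℝ)) (b := 1)).prod (isCompact_Icc (a := (0 : ℝ)) (b := 1)))
  rwa [IntegrableOn, Measure.restrict_eq_self_of_ae_mem (hμ.ae_mem hC)] at h

theorem IsInducedMeasure.integral_fst {C : ℝ → ℝ → ℝ} (hC : IsCopula C) {μ : Measure (ℝ × ℝ)}
    (hμ : IsInducedMeasure C μ) : ∫ z, z.1 ∂μ = 1 / 2 := by
  have := hμ.prob
  have h := hμ.integral_section hC continuous_id (continuous_const (y := (1 : ℝ)))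
    (fun t ht => ht) (fun t _ => ⟨zero_le_one, le_rfl⟩)
  have h1 : ∫ t in (0 : ℝ)..1, C (id t) 1 = 1 / 2 := by
    rw [intervalIntegral.integral_congr (g := fun t => t)]
    · simp
    · intro t ht
      rw [uIcc_of_le zero_le_one] at ht
      exact hC.one_right t ht
  rw [h1, integral_congr_ae (g := fun z => 1 - z.1), integral_sub (integrable_const _)
    (hμ.integrable hC continuous_fst)] at h
  · simp at h
    linarith
  · filter_upwards [hμ.ae_mem hC] with z hz
    rw [show {t | t ∈ Icc (0 : ℝ) 1 ∧ z.1 ≤ id t ∧ z.2 ≤ 1} = Icc z.1 1 from ?_,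
      Real.volume_real_Icc_of_le hz.1.2]
    ext t
    have h1 := hz.1.1
    have h2 := hz.2.2
    simp only [mem_Icc, mem_ofPred_eq, id]
    grind

theorem IsInducedMeasure.integral_snd {C : ℝ → ℝ → ℝ} (hC : IsCopula C) {μ : Measure (ℝ × ℝ)}
    (hμ : IsInducedMeasure C μ) : ∫ z, z.2 ∂μ = 1 / 2 := by
  have := hμ.prob
  have h := hμ.integral_section hC (continuous_const (y := (1 : ℝ))) continuous_id
    (fun t _ => ⟨zero_le_one, le_rfl⟩) (fun t ht => ht)
  have h1 : ∫ t in (0 : ℝ)..1, C 1 (id t) = 1 / 2 := by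
    rw [intervalIntegral.integral_congr (g := fun t => t)]
    · simp
    · intro t ht
      rw [uIcc_of_le zero_le_one] at ht
      exact hC.one_left t ht
  rw [h1, integral_congr_ae (g := fun z => 1 - z.2), integral_sub (integrable_const _)
    (hμ.integrable hC continuous_snd)] at h
  · simp at h
    linarith
  · filter_upwards [hμ.ae_mem hC] with z hz
    rw [show {t | t ∈ Icc (0 : ℝ) 1 ∧ z.1 ≤ 1 ∧ z.2 ≤ id t} = Icc z.2 1 from ?_,
      Real.volume_real_Icc_of_le hz.2.2]
    ext t
    have h1 := hz.2.1
    have h2 := hz.1.2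
    simp only [mem_Icc, mem_ofPred_eq, id]
    grind

/-- The mean of `M` is the integral of the copula over the diagonal. -/
theorem IsInducedMeasure.integral_copM {C : ℝ → ℝ → ℝ} (hC : IsCopula C) {μ : Measure (ℝ × ℝ)}
    (hμ : IsInducedMeasure C μ) : ∫ z, copM z.1 z.2 ∂μ = ∫ t in (0 : ℝ)..1, C t t := by
  have := hμ.prob
  have h := hμ.integral_section hC continuous_id continuous_id (fun t ht => ht) (fun t ht => ht)
  simp only [id] at h
  have hM : Integrable (fun z : ℝ × ℝ => copM z.1 z.2) μ :=
    hμ.integrable hC (by unfold copM; fun_prop)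
  have h1 := hμ.integrable hC continuous_fst
  have h2 := hμ.integrable hC continuous_snd
  -- The section has length `1 - max x y = 1 - x - y + min x y`, and the coordinates have mean
  -- `1/2`, so only the mean of `M` survives.
  rw [← h, integral_congr_ae (g := fun z => 1 - z.1 - z.2 + copM z.1 z.2)
      (f := fun z => volume.real _),
    integral_add (by fun_prop) hM, integral_sub (by fun_prop) h2,
    integral_sub (by fun_prop) h1, hμ.integral_fst hC, hμ.integral_snd hC]
  · norm_num
  · filter_upwards [hμ.ae_mem hC] with z hz
    rw [show {t | t ∈ Icc (0 : ℝ) 1 ∧ z.1 ≤ t ∧ z.2 ≤ t} = Icc (max z.1 z.2) 1 from ?_,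
      Real.volume_real_Icc_of_le (max_le hz.1.2 hz.2.2), copM]
    · linarith [min_add_max z.1 z.2]
    ext t
    have h1 := hz.2.1
    have h2 := hz.1.1
    simp only [mem_Icc, mem_ofPred_eq, max_le_iff]
    grind

/-- The mean of `W` is the integral of the copula over the antidiagonal. -/
theorem IsInducedMeasure.integral_copW {C : ℝ → ℝ → ℝ} (hC : IsCopula C) {μ : Measure (ℝ × ℝ)}
    (hμ : IsInducedMeasure C μ) :
    ∫ z, copW z.1 z.2 ∂μ = ∫ t in (0 : ℝ)..1, C t (1 - t) := by
  have := hμ.prob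
  have h := hμ.integral_section hC continuous_id (s := fun t => 1 - t) (by fun_prop)
    (fun t ht => ht) (fun t ht => ⟨by simpa using ht.2, by simpa using ht.1⟩)
  simp only [id] at h
  have hM : Integrable (fun z : ℝ × ℝ => copW z.1 z.2) μ :=
    hμ.integrable hC (by unfold copW; fun_prop)
  have h1 := hμ.integrable hC continuous_fst
  have h2 := hμ.integrable hC continuous_snd
  rw [← h, integral_congr_ae (g := fun z => 1 - z.1 - z.2 + copW z.1 z.2)
      (f := fun z => volume.real _),
    integral_add (by fun_prop) hM, integral_sub (by fun_prop) h2,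
    integral_sub (by fun_prop) h1, hμ.integral_fst hC, hμ.integral_snd hC]
  · norm_num
  · filter_upwards [hμ.ae_mem hC] with z hz
    rw [show {t | t ∈ Icc (0 : ℝ) 1 ∧ z.1 ≤ t ∧ z.2 ≤ 1 - t} = Icc z.1 (1 - z.2) from ?_,
      Real.volume_real_Icc, copW]
    · grind
    ext t
    have h1 := hz.2.1
    have h2 := hz.1.1
    simp only [mem_Icc, mem_ofPred_eq]
    grind

/-! ### Explicit integrals over shuffles. -/

theorem integral_quadratic (A B D p q : ℝ) : ∫ x in p..q, (A + B * x + D * x ^ 2) =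
    A * (q - p) + B * (q ^ 2 - p ^ 2) / 2 + D * (q ^ 3 - p ^ 3) / 3 := by
  rw [intervalIntegral.integral_add, intervalIntegral.integral_add,
    intervalIntegral.integral_const, intervalIntegral.integral_const_mul,
    intervalIntegral.integral_const_mul, integral_id, integral_pow]
  · simp only [smul_eq_mul]; push_cast; ring
  all_goals exact Continuous.intervalIntegrable (by fun_prop) _ _

theorem integral_eq_of_quadratic {f : ℝ → ℝ} {p q : ℝ} (hpq : p ≤ q) (A B D : ℝ)
    (hf : ∀ x ∈ Icc p q, f x = A + B * x + D * x ^ 2) : ∫ x in p..q, f x =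
    A * (q - p) + B * (q ^ 2 - p ^ 2) / 2 + D * (q ^ 3 - p ^ 3) / 3 := by
  rw [← integral_quadratic]
  exact intervalIntegral.integral_congr fun x hx => hf x (by rwa [uIcc_of_le hpq] at hx)

theorem isInducedMeasure_upperForm {p q d : ℝ} (h : Admissible p q d) :
    IsInducedMeasure (upperForm p q d) (shuffle p q d id) :=
  isInducedMeasure_of_apply h continuous_id fun _ hu _ hv => shuffle_id_apply h hu hv

theorem isInducedMeasure_reflectedForm {p q d : ℝ} (h : Admissible p q d) :
    IsInducedMeasure (reflectedForm p q d) (shuffle p q d fun y => 1 - y) :=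
  isInducedMeasure_of_apply h (by fun_prop) fun _ hu _ hv => shuffle_sub_apply h hu hv

theorem integral_shuffle_reflect {p q d : ℝ} (h : Admissible p q d) {G : ℝ → ℝ → ℝ}
    (hG : Continuous fun z : ℝ × ℝ => G z.1 z.2) :
    ∫ z, G z.1 z.2 ∂(shuffle p q d fun y => 1 - y) =
      ∫ z, G z.1 (1 - z.2) ∂(shuffle p q d id) := by
  have hG' : Continuous fun z : ℝ × ℝ => G z.1 (1 - z.2) :=
    hG.comp (f := fun z : ℝ × ℝ => (z.1, 1 - z.2)) (by fun_prop)
  rw [integral_shuffle h (by fun_prop) hG, integral_shuffle h continuous_id hG']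
  rfl

theorem integral_shuffle_mul {p q d : ℝ} (h : Admissible p q d) :
    ∫ z, z.1 * z.2 ∂(shuffle p q d id) =
      1 / 3 - (p - d) * (q - d) * ((p - d) + (q - d)) / 2 := by
  have hG : Continuous fun z : ℝ × ℝ => z.1 * z.2 := by fun_prop
  rw [integral_shuffle h continuous_id hG]
  obtain ⟨h1, h2, h3, h4⟩ := h
  simp only [id]
  rw [integral_eq_of_quadratic h1 0 0 1 fun x _ => by ring,
    integral_eq_of_quadratic h2 0 (q - d) 1 fun x _ => by ring,
    integral_eq_of_quadratic (by linarith) 0 (d - p) 1 fun x _ => by ring,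
    integral_eq_of_quadratic h4 0 0 1 fun x _ => by ring]
  ring

/-- The integrand is `x` except on the third segment, of horizontal length `q - d`, where it drops
by `p - d`. Only values on the support matter, so this serves both `M` and `upperForm` itself, which
agree there. -/
theorem integral_shuffle_min_of {p q d : ℝ} (h : Admissible p q d) {G : ℝ × ℝ → ℝ}
    (hG : Continuous G) (h1 : ∀ x ∈ Icc (0 : ℝ) d, G (x, x) = x)
    (h2 : ∀ x ∈ Icc d p, G (x, x + (q - d)) = x)
    (h3 : ∀ x ∈ Icc p (p + q - d), G (x, x + (d - p)) = x + (d - p))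
    (h4 : ∀ x ∈ Icc (p + q - d) 1, G (x, x) = x) :
    ∫ z, G z ∂(shuffle p q d id) = 1 / 2 - (p - d) * (q - d) := by
  rw [integral_shuffle h continuous_id hG]
  obtain ⟨k1, k2, k3, k4⟩ := h
  simp only [id]
  rw [integral_eq_of_quadratic k1 0 1 0 fun x hx => by rw [h1 x hx]; ring,
    integral_eq_of_quadratic k2 0 1 0 fun x hx => by rw [h2 x hx]; ring,
    integral_eq_of_quadratic (by linarith) (d - p) 1 0 fun x hx => by rw [h3 x hx]; ring,
    integral_eq_of_quadratic k4 0 1 0 fun x hx => by rw [h4 x hx]; ring]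
  ring

theorem integral_shuffle_min {p q d : ℝ} (h : Admissible p q d) :
    ∫ z, min z.1 z.2 ∂(shuffle p q d id) = 1 / 2 - (p - d) * (q - d) := by
  have := h.le_left
  have := h.le_right
  refine integral_shuffle_min_of h (by fun_prop) (fun x _ => min_self x)
    (fun x _ => min_eq_left (by linarith)) (fun x _ => min_eq_right (by linarith))
    (fun x _ => min_self x)

theorem continuous_upperForm (p q d : ℝ) :
    Continuous fun z : ℝ × ℝ => upperForm p q d z.1 z.2 := by
  unfold upperForm
  fun_prop

theorem continuous_reflectedForm (p q d : ℝ) :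
    Continuous fun z : ℝ × ℝ => reflectedForm p q d z.1 z.2 := by
  unfold reflectedForm upperForm
  fun_prop

theorem integral_shuffle_upperForm {p q d : ℝ} (h : Admissible p q d) :
    ∫ z, upperForm p q d z.1 z.2 ∂(shuffle p q d id) = 1 / 2 - (p - d) * (q - d) := by
  obtain ⟨h1, h2, h3, h4⟩ := id h
  refine integral_shuffle_min_of h (continuous_upperForm p q d) ?_ ?_ ?_ ?_
  all_goals
    rintro x ⟨hx1, hx2⟩
    simp only [upperForm]
    grind

/-! ### The measures of concordance for shuffles and their reflections. -/

theorem eval_rho_upperForm {p q d : ℝ} (h : Admissible p q d) :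
    Kappa.rho.eval (upperForm p q d) = 1 - 6 * ((p - d) * (q - d) * ((p - d) + (q - d))) := by
  simp only [Kappa.eval, (isInducedMeasure_upperForm h).concordance_eq (isCopula_upperForm h),
    copPi, integral_shuffle_mul h]
  ring

theorem eval_tau_upperForm {p q d : ℝ} (h : Admissible p q d) :
    Kappa.tau.eval (upperForm p q d) = 1 - 4 * ((p - d) * (q - d)) := by
  simp only [Kappa.eval, (isInducedMeasure_upperForm h).concordance_eq (isCopula_upperForm h),
    integral_shuffle_upperForm h]
  ring

theorem eval_phi_upperForm {p q d : ℝ} (h : Admissible p q d) :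
    Kappa.phi.eval (upperForm p q d) = 1 - 6 * ((p - d) * (q - d)) := by
  simp only [Kappa.eval, (isInducedMeasure_upperForm h).concordance_eq (isCopula_upperForm h),
    copM, integral_shuffle_min h]
  ring

theorem eval_gamma_upperForm {p q d : ℝ} (h : Admissible p q d) :
    Kappa.gamma.eval (upperForm p q d) =
      4 * (∫ t in (0 : ℝ)..1, upperForm p q d t (1 - t)) - 4 * ((p - d) * (q - d)) := by
  have hμ := isInducedMeasure_upperForm h
  have hC := isCopula_upperForm h
  simp only [Kappa.eval, hμ.concordance_eq hC, hμ.integral_copW hC]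
  simp only [copM, integral_shuffle_min h]
  ring

theorem eval_rho_reflectedForm {p q d : ℝ} (h : Admissible p q d) :
    Kappa.rho.eval (reflectedForm p q d) =
      6 * ((p - d) * (q - d) * ((p - d) + (q - d))) - 1 := by
  have hμ := isInducedMeasure_upperForm h
  have hC := isCopula_upperForm h
  simp only [Kappa.eval, copPi,
    (isInducedMeasure_reflectedForm h).concordance_eq (isCopula_reflectedForm h)]
  rw [integral_shuffle_reflect h (G := fun x y => x * y) (by fun_prop)]
  simp only [mul_sub, mul_one]
  rw [integral_sub (hμ.integrable hC (by fun_prop)) (hμ.integrable hC (by fun_prop)),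
    integral_shuffle_mul h, hμ.integral_fst hC]
  ring

theorem integral_shuffle_sub_min {p q d : ℝ} (h : Admissible p q d) {G : ℝ → ℝ → ℝ}
    (hG : Continuous fun z : ℝ × ℝ => G z.1 z.2)
    (hI : ∫ z, G z.1 z.2 ∂(shuffle p q d id) = 1 / 2 - (p - d) * (q - d)) :
    ∫ z, (z.1 - G z.1 z.2) ∂(shuffle p q d id) = (p - d) * (q - d) := by
  have hμ := isInducedMeasure_upperForm h
  have hC := isCopula_upperForm h
  rw [integral_sub (hμ.integrable hC (by fun_prop)) (hμ.integrable hC hG), hI,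
    hμ.integral_fst hC]
  ring

theorem eval_tau_reflectedForm {p q d : ℝ} (h : Admissible p q d) :
    Kappa.tau.eval (reflectedForm p q d) = 4 * ((p - d) * (q - d)) - 1 := by
  simp only [Kappa.eval,
    (isInducedMeasure_reflectedForm h).concordance_eq (isCopula_reflectedForm h)]
  rw [integral_shuffle_reflect h (continuous_reflectedForm p q d)]
  simp only [reflectedForm, sub_sub_cancel]
  rw [integral_shuffle_sub_min h (continuous_upperForm p q d) (integral_shuffle_upperForm h)]

theorem eval_phi_reflectedForm {p q d : ℝ} (h : Admissible p q d) :
    Kappa.phi.eval (reflectedForm p q d) =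
      6 * (∫ t in (0 : ℝ)..1, reflectedForm p q d t t) - 2 := by
  have hμ := isInducedMeasure_reflectedForm h
  have hC := isCopula_reflectedForm h
  simp only [Kappa.eval, hμ.concordance_eq hC, hμ.integral_copM hC]
  ring

theorem eval_gamma_reflectedForm {p q d : ℝ} (h : Admissible p q d) :
    Kappa.gamma.eval (reflectedForm p q d) =
      4 * (∫ t in (0 : ℝ)..1, reflectedForm p q d t t) + 4 * ((p - d) * (q - d)) - 2 := by
  have hμ := isInducedMeasure_reflectedForm h
  have hC := isCopula_reflectedForm h
  have hW : ∫ z, copW z.1 z.2 ∂(shuffle p q d fun y => 1 - y) = (p - d) * (q - d) := by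
    rw [integral_shuffle_reflect h (by unfold copW; fun_prop),
      ← integral_shuffle_sub_min h (G := min) (by fun_prop) (integral_shuffle_min h)]
    -- Here `W(x, 1 - y) = max 0 (x - y) = x - min x y`.
    congr 1 with z
    grind [copW]
  simp only [Kappa.eval, hμ.concordance_eq hC, hμ.integral_copM hC, hW]
  ring

/-! ### The triangle -/

/-- The three inequalities are the edges `RT`, `RU` and `UT`. For `m < 1/3` their slacks, scaled,
are the barycentric coordinates; at `m = 1/3` the triangle is a point. -/
theorem mem_triangle_iff {m : ℝ} (hm : m ≤ 1 / 3) (z : ℝ × ℝ) :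
    z ∈ triangle m ↔ m ≤ z.1 ∧ z.1 + m ≤ z.2 ∧ z.1 + z.2 ≤ 1 := by
  obtain ⟨a, b⟩ := z
  have key : (a, b) ∈ triangle m ↔ ∃ r u t : ℝ, 0 ≤ r ∧ 0 ≤ u ∧ 0 ≤ t ∧ r + u + t = 1 ∧
      r * m + u * ((1 - m) / 2) + t * m = a ∧
      r * (2 * m) + u * ((1 + m) / 2) + t * (1 - m) = b := by
    rw [triangle, convexHull_insert (by simp), mem_convexJoin]
    simp only [mem_singleton_iff, exists_eq_left, convexHull_pair]
    constructor
    · rintro ⟨y, ⟨u, t, hu, ht, hut, rfl⟩, r, s, hr, hs, hrs, hz⟩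
      simp only [vertexR, vertexU, vertexT, Prod.smul_mk, smul_eq_mul, Prod.mk_add_mk,
        Prod.mk.injEq] at hz
      refine ⟨r, s * u, s * t, hr, by positivity, by positivity, ?_, ?_, ?_⟩
      · rw [add_assoc, ← mul_add, hut, mul_one, hrs]
      · rw [← hz.1]; ring
      · rw [← hz.2]; ring
    · rintro ⟨r, u, t, hr, hu, ht, h1, h2, h3⟩
      -- The weights on `U` and `T` are normalised to a point of the edge `UT`; if both vanish, any
      -- point of that edge will do, and `U` is taken.
      rcases (add_nonneg hu ht).eq_or_lt with h0 | h0
      · refine ⟨vertexU m, left_mem_segment _ _ _, r, u + t, hr, h0.le, by linarith, ?_⟩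
        have hu0 : u = 0 := by linarith
        have ht0 : t = 0 := by linarith
        subst hu0 ht0
        simp only [vertexR, vertexU, Prod.smul_mk, smul_eq_mul, Prod.mk_add_mk, Prod.mk.injEq]
        constructor <;> linarith
      · refine ⟨(u / (u + t)) • vertexU m + (t / (u + t)) • vertexT m,
          ⟨_, _, by positivity, by positivity, by field_simp, rfl⟩, r, u + t, hr, h0.le,
          by linarith, ?_⟩
        simp only [vertexR, vertexU, vertexT, Prod.smul_mk, smul_eq_mul, Prod.mk_add_mk,
          Prod.mk.injEq]
        constructor
        · rw [← h2]; field_simp; ring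
        · rw [← h3]; field_simp; ring
  rw [key]
  constructor
  · rintro ⟨r, u, t, hr, hu, ht, h1, rfl, rfl⟩
    have hr' : r = 1 - u - t := by linarith
    subst hr'
    refine ⟨?_, ?_, ?_⟩ <;> nlinarith
  · rintro ⟨h1, h2, h3⟩
    simp only at h1 h2 h3
    rcases hm.eq_or_lt with rfl | hm
    · exact ⟨1, 0, 0, by norm_num, by norm_num, by norm_num, by norm_num, by linarith, by linarith⟩
    · have h0 : 0 < 1 - 3 * m := by linarith
      refine ⟨(1 - a - b) / (1 - 3 * m), 2 * (a - m) / (1 - 3 * m), (b - a - m) / (1 - 3 * m),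
        div_nonneg (by linarith) h0.le, div_nonneg (by linarith) h0.le,
        div_nonneg (by linarith) h0.le, ?_, ?_, ?_⟩
      all_goals field_simp; ring

theorem mem_segment_UT_iff {m : ℝ} (hm : m ≤ 1 / 3) (z : ℝ × ℝ) :
    z ∈ segment ℝ (vertexU m) (vertexT m) ↔ z ∈ triangle m ∧ z.1 + z.2 = 1 := by
  rw [mem_triangle_iff hm]
  obtain ⟨a, b⟩ := z
  constructor
  · rintro ⟨u, t, hu, ht, hut, hz⟩
    simp only [vertexU, vertexT, Prod.smul_mk, smul_eq_mul, Prod.mk_add_mk, Prod.mk.injEq] at hz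
    obtain ⟨rfl, rfl⟩ := hz
    have : t = 1 - u := by linarith
    subst this
    refine ⟨⟨?_, ?_, ?_⟩, ?_⟩ <;> nlinarith
  · rintro ⟨⟨h1, h2, h3⟩, h4⟩
    simp only at h1 h2 h3 h4
    rcases hm.eq_or_lt with rfl | hm
    · convert left_mem_segment ℝ (vertexU (1 / 3)) (vertexT (1 / 3)) using 1
      simp only [vertexU, Prod.mk.injEq]
      constructor <;> linarith
    · have h0 : 0 < 1 - 3 * m := by linarith
      have h0' : 1 - m * 3 ≠ 0 := by linarith
      refine ⟨2 * (a - m) / (1 - 3 * m), (b - a - m) / (1 - 3 * m),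
        div_nonneg (by linarith) h0.le, div_nonneg (by linarith) h0.le, ?_, ?_⟩
      · field_simp; linarith
      · simp only [vertexU, vertexT, Prod.smul_mk, smul_eq_mul, Prod.mk_add_mk, Prod.mk.injEq]
        have hb : b = 1 - a := by linarith
        subst hb
        constructor <;> field_simp <;> ring

theorem mem_segment_RU_iff {m : ℝ} (hm : m ≤ 1 / 3) (z : ℝ × ℝ) :
    z ∈ segment ℝ (vertexR m) (vertexU m) ↔ z ∈ triangle m ∧ z.2 = z.1 + m := by
  rw [mem_triangle_iff hm]
  obtain ⟨a, b⟩ := z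
  constructor
  · rintro ⟨r, u, hr, hu, hru, hz⟩
    simp only [vertexU, vertexR, Prod.smul_mk, smul_eq_mul, Prod.mk_add_mk, Prod.mk.injEq] at hz
    obtain ⟨rfl, rfl⟩ := hz
    have : r = 1 - u := by linarith
    subst this
    refine ⟨⟨?_, ?_, ?_⟩, ?_⟩ <;> nlinarith
  · rintro ⟨⟨h1, h2, h3⟩, h4⟩
    simp only at h1 h2 h3 h4
    rcases hm.eq_or_lt with rfl | hm
    · convert left_mem_segment ℝ (vertexR (1 / 3)) (vertexU (1 / 3)) using 1
      simp only [vertexR, Prod.mk.injEq]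
      constructor <;> linarith
    · have h0 : 0 < 1 - 3 * m := by linarith
      have h0' : 1 - m * 3 ≠ 0 := by linarith
      subst h4
      refine ⟨(1 - a - (a + m)) / (1 - 3 * m), 2 * (a - m) / (1 - 3 * m),
        div_nonneg (by linarith) h0.le, div_nonneg (by linarith) h0.le, ?_, ?_⟩
      · field_simp; ring
      · simp only [vertexU, vertexR, Prod.smul_mk, smul_eq_mul, Prod.mk_add_mk, Prod.mk.injEq]
        constructor <;> field_simp <;> ring

/-- The inner maximum is `d₂ + max 0 (u - b) + max 0 (v - a)`, so the prescribed value sits at the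
transposed point `(b, a)`. -/
theorem upperBound_eq {a b m : ℝ} (hab : a ≤ b) :
    upperBound a b m = upperForm b a (a - m) := by
  ext u v
  simp only [upperBound, upperForm, copM, min_eq_left hab]
  congr 1
  rcases le_total u b with h1 | h1 <;> rcases le_total v a with h2 | h2
  all_goals grind

/-- The inner minimum is `m - max 0 (a - u) - max 0 (b - v)`, since `W(a, b) = 0` here; reflection
turns it into the maximal form at `(a, 1 - b)`. -/
theorem lowerBound_eq {a b m : ℝ} (hab : a + b ≤ 1) :
    lowerBound a b m = reflectedForm a (1 - b) (a - m) := by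
  ext u v
  have h0 : copW a b = 0 := max_eq_left (by linarith)
  simp only [lowerBound, reflectedForm, upperForm, h0, zero_add]
  unfold copW
  rcases le_total u a with h1 | h1 <;> rcases le_total v b with h2 | h2
  all_goals grind

theorem admissible_upper {m : ℝ} (hm : m ∈ Icc (0 : ℝ) (1 / 3)) {z : ℝ × ℝ}
    (hz : z ∈ triangle m) : Admissible z.2 z.1 (z.1 - m) := by
  obtain ⟨h1, h2, h3⟩ := (mem_triangle_iff hm.2 z).1 hz
  have := hm.1
  constructor <;> linarith

theorem admissible_lower {m : ℝ} (hm : m ∈ Icc (0 : ℝ) (1 / 3)) {z : ℝ × ℝ}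
    (hz : z ∈ triangle m) : Admissible z.1 (1 - z.2) (z.1 - m) := by
  obtain ⟨h1, h2, h3⟩ := (mem_triangle_iff hm.2 z).1 hz
  have := hm.1
  constructor <;> linarith

theorem upperBound_eq_of_mem {m : ℝ} (hm : m ∈ Icc (0 : ℝ) (1 / 3)) {z : ℝ × ℝ}
    (hz : z ∈ triangle m) : upperBound z.1 z.2 m = upperForm z.2 z.1 (z.1 - m) :=
  upperBound_eq (by linarith [hm.1, ((mem_triangle_iff hm.2 z).1 hz).2.1])

theorem lowerBound_eq_of_mem {m : ℝ} (hm : m ∈ Icc (0 : ℝ) (1 / 3)) {z : ℝ × ℝ}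
    (hz : z ∈ triangle m) : lowerBound z.1 z.2 m = reflectedForm z.1 (1 - z.2) (z.1 - m) :=
  lowerBound_eq ((mem_triangle_iff hm.2 z).1 hz).2.2

/-! ### The lower bounds -/

/-- The values of the lower bounds on the diagonal, which depend only on the second coordinate
of the point. -/
def diagonalSection (m b t : ℝ) : ℝ := max (copW t t) (m - max 0 (b - t))

theorem continuous_diagonalSection (m b : ℝ) : Continuous (diagonalSection m b) := by
  unfold diagonalSection copW
  fun_prop

/-- The term in `a` matters only for `t < a`, and there `b - t ≥ m` makes the inner expression
nonpositive anyway, so `W` prevails. -/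
theorem reflectedForm_diagonal {m : ℝ} (hm : m ∈ Icc (0 : ℝ) (1 / 3)) {z : ℝ × ℝ}
    (hz : z ∈ triangle m) (t : ℝ) :
    reflectedForm z.1 (1 - z.2) (z.1 - m) t t = diagonalSection m z.2 t := by
  obtain ⟨h1, h2, h3⟩ := (mem_triangle_iff hm.2 z).1 hz
  have := hm.1
  simp only [reflectedForm, upperForm, diagonalSection, copW]
  grind (splits := 20)

theorem diagonalSection_antitone (m t : ℝ) {b b' : ℝ} (h : b ≤ b') :
    diagonalSection m b' t ≤ diagonalSection m b t := by
  unfold diagonalSection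
  gcongr

theorem diagonalSection_eq_copW {m b : ℝ} (hm : 0 ≤ m) (h : m + 1 / 2 ≤ b) (t : ℝ) :
    diagonalSection m b t = copW t t := by
  unfold diagonalSection copW
  grind

theorem integral_diagonalSection_antitone (m : ℝ) {b b' : ℝ} (h : b ≤ b') :
    ∫ t in (0 : ℝ)..1, diagonalSection m b' t ≤ ∫ t in (0 : ℝ)..1, diagonalSection m b t :=
  intervalIntegral.integral_mono zero_le_one
    ((continuous_diagonalSection m b').intervalIntegrable _ _)
    ((continuous_diagonalSection m b).intervalIntegrable _ _)
    fun t => diagonalSection_antitone m t h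

theorem integral_diagonalSection_lt {m b : ℝ} (hm : 0 < m) (hm' : m ≤ 1 / 3) (h : b < 1 - m)
    (hb : b < m + 1 / 2) :
    ∫ t in (0 : ℝ)..1, diagonalSection m (1 - m) t < ∫ t in (0 : ℝ)..1, diagonalSection m b t := by
  refine intervalIntegral.integral_lt_integral_of_continuousOn_of_le_of_exists_lt zero_lt_one
    (continuous_diagonalSection m _).continuousOn (continuous_diagonalSection m b).continuousOn
    -- At `t = 1/2` the diagonal of `W` is still zero, and `b < m + 1/2` makes the section positive
    -- there.
    (fun t _ => diagonalSection_antitone m t h.le) ⟨1 / 2, by norm_num, ?_⟩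
  unfold diagonalSection copW
  grind

theorem eval_rho_lowerBound {m : ℝ} (hm : m ∈ Icc (0 : ℝ) (1 / 3)) {z : ℝ × ℝ}
    (hz : z ∈ triangle m) : Kappa.rho.eval (lowerBound z.1 z.2 m) =
      6 * (m * (1 - z.1 - z.2 + m) * (1 - z.1 - z.2 + 2 * m)) - 1 := by
  rw [lowerBound_eq_of_mem hm hz, eval_rho_reflectedForm (admissible_lower hm hz)]
  ring

theorem eval_tau_lowerBound {m : ℝ} (hm : m ∈ Icc (0 : ℝ) (1 / 3)) {z : ℝ × ℝ}
    (hz : z ∈ triangle m) : Kappa.tau.eval (lowerBound z.1 z.2 m) =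
      4 * (m * (1 - z.1 - z.2 + m)) - 1 := by
  rw [lowerBound_eq_of_mem hm hz, eval_tau_reflectedForm (admissible_lower hm hz)]
  ring

theorem eval_phi_lowerBound {m : ℝ} (hm : m ∈ Icc (0 : ℝ) (1 / 3)) {z : ℝ × ℝ}
    (hz : z ∈ triangle m) : Kappa.phi.eval (lowerBound z.1 z.2 m) =
      6 * (∫ t in (0 : ℝ)..1, diagonalSection m z.2 t) - 2 := by
  rw [lowerBound_eq_of_mem hm hz, eval_phi_reflectedForm (admissible_lower hm hz)]
  simp only [reflectedForm_diagonal hm hz]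

theorem eval_gamma_lowerBound {m : ℝ} (hm : m ∈ Icc (0 : ℝ) (1 / 3)) {z : ℝ × ℝ}
    (hz : z ∈ triangle m) : Kappa.gamma.eval (lowerBound z.1 z.2 m) =
      4 * (∫ t in (0 : ℝ)..1, diagonalSection m z.2 t) +
        4 * (m * (1 - z.1 - z.2 + m)) - 2 := by
  rw [lowerBound_eq_of_mem hm hz, eval_gamma_reflectedForm (admissible_lower hm hz)]
  simp only [reflectedForm_diagonal hm hz]
  ring

theorem eval_beta_lowerBound {m : ℝ} (hm : m ∈ Icc (0 : ℝ) (1 / 3)) {z : ℝ × ℝ}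
    (hz : z ∈ triangle m) : Kappa.beta.eval (lowerBound z.1 z.2 m) =
      4 * max 0 (m - max 0 (z.2 - 1 / 2)) - 1 := by
  rw [lowerBound_eq_of_mem hm hz, Kappa.eval, reflectedForm_diagonal hm hz]
  norm_num [diagonalSection, copW]

/-! ### The upper bounds -/

theorem eval_rho_upperBound {m : ℝ} (hm : m ∈ Icc (0 : ℝ) (1 / 3)) {z : ℝ × ℝ}
    (hz : z ∈ triangle m) : Kappa.rho.eval (upperBound z.1 z.2 m) =
      1 - 6 * (m * (z.2 - z.1 + m) * (z.2 - z.1 + 2 * m)) := by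
  rw [upperBound_eq_of_mem hm hz, eval_rho_upperForm (admissible_upper hm hz)]
  ring

theorem eval_tau_upperBound {m : ℝ} (hm : m ∈ Icc (0 : ℝ) (1 / 3)) {z : ℝ × ℝ}
    (hz : z ∈ triangle m) : Kappa.tau.eval (upperBound z.1 z.2 m) =
      1 - 4 * (m * (z.2 - z.1 + m)) := by
  rw [upperBound_eq_of_mem hm hz, eval_tau_upperForm (admissible_upper hm hz)]
  ring

theorem eval_phi_upperBound {m : ℝ} (hm : m ∈ Icc (0 : ℝ) (1 / 3)) {z : ℝ × ℝ}
    (hz : z ∈ triangle m) : Kappa.phi.eval (upperBound z.1 z.2 m) =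
      1 - 6 * (m * (z.2 - z.1 + m)) := by
  rw [upperBound_eq_of_mem hm hz, eval_phi_upperForm (admissible_upper hm hz)]
  ring

/-- The values of the upper bounds on the antidiagonal. -/
def antidiagonalSection (m : ℝ) (z : ℝ × ℝ) (t : ℝ) : ℝ :=
  upperForm z.2 z.1 (z.1 - m) t (1 - t)

theorem continuous_antidiagonalSection (m : ℝ) (z : ℝ × ℝ) :
    Continuous (antidiagonalSection m z) := by
  unfold antidiagonalSection upperForm
  fun_prop

theorem eval_gamma_upperBound {m : ℝ} (hm : m ∈ Icc (0 : ℝ) (1 / 3)) {z : ℝ × ℝ}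
    (hz : z ∈ triangle m) : Kappa.gamma.eval (upperBound z.1 z.2 m) =
      4 * (∫ t in (0 : ℝ)..1, antidiagonalSection m z t) - 4 * (m * (z.2 - z.1 + m)) := by
  rw [upperBound_eq_of_mem hm hz, eval_gamma_upperForm (admissible_upper hm hz)]
  simp only [antidiagonalSection]
  ring

theorem eval_beta_upperBound {m : ℝ} (hm : m ∈ Icc (0 : ℝ) (1 / 3)) {z : ℝ × ℝ}
    (hz : z ∈ triangle m) : Kappa.beta.eval (upperBound z.1 z.2 m) =
      4 * min (1 / 2) (1 / 2 - m + max 0 (1 / 2 - z.2)) - 1 := by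
  obtain ⟨h1, h2, h3⟩ := (mem_triangle_iff hm.2 z).1 hz
  have := hm.1
  rw [upperBound_eq_of_mem hm hz, Kappa.eval, upperForm, min_self,
    max_eq_right (a := (0 : ℝ)) (b := 1 / 2 - z.1) (by linarith)]
  ring_nf

/-- If `1 - t ≥ a`, the inner sum is `1 - t - m + max 0 (t - b)`, and `b ≥ 2m` suffices. Otherwise
`t > 1 - a ≥ b`, so it is `t - m - (b - a) ≤ t - 2m`. -/
theorem antidiagonalSection_le {m : ℝ} (hm : m ∈ Icc (0 : ℝ) (1 / 3)) {z : ℝ × ℝ}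
    (hz : z ∈ triangle m) (t : ℝ) :
    antidiagonalSection m z t ≤ antidiagonalSection m (vertexR m) t := by
  obtain ⟨h1, h2, h3⟩ := (mem_triangle_iff hm.2 z).1 hz
  have := hm.1
  simp only [antidiagonalSection, upperForm, vertexR]
  refine min_le_min_left _ ?_
  grind

theorem integral_antidiagonalSection_le {m : ℝ} (hm : m ∈ Icc (0 : ℝ) (1 / 3)) {z : ℝ × ℝ}
    (hz : z ∈ triangle m) : ∫ t in (0 : ℝ)..1, antidiagonalSection m z t ≤
      ∫ t in (0 : ℝ)..1, antidiagonalSection m (vertexR m) t :=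
  intervalIntegral.integral_mono zero_le_one
    ((continuous_antidiagonalSection m z).intervalIntegrable _ _)
    ((continuous_antidiagonalSection m _).intervalIntegrable _ _)
    fun t => antidiagonalSection_le hm hz t

theorem integral_antidiagonalSection_lt {m : ℝ} (hm : m ∈ Icc (1 / 6 : ℝ) (1 / 3)) {z : ℝ × ℝ}
    (hz : z ∈ triangle m) (hz' : m < z.1) (hzb : z.2 = z.1 + m) :
    ∫ t in (0 : ℝ)..1, antidiagonalSection m z t <
      ∫ t in (0 : ℝ)..1, antidiagonalSection m (vertexR m) t := by
  have hm0 := hm.1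
  obtain ⟨h1, h2, h3⟩ := (mem_triangle_iff hm.2 z).1 hz
  refine intervalIntegral.integral_lt_integral_of_continuousOn_of_le_of_exists_lt zero_lt_one
    (continuous_antidiagonalSection m _).continuousOn
    (continuous_antidiagonalSection m _).continuousOn
    (fun t _ => antidiagonalSection_le ⟨by linarith, hm.2⟩ hz t)
    -- At this `t` the inner sum for `z` is `1 - 2m - a`, strictly below both `min t (1 - t)` and
    -- the inner sum `1 - 3m` for `R`. If `t = 1/2`, this uses `a > m ≥ 1/2 - 2m`, which is where `m
    -- ≥ 1/6` enters.
    ⟨max (z.1 + m) (1 / 2), ⟨by positivity, max_le (by linarith) (by norm_num)⟩, ?_⟩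
  simp only [antidiagonalSection, upperForm, vertexR]
  rcases le_total (z.1 + m) (1 / 2) with h | h
  · rw [max_eq_right h]
    grind
  · rw [max_eq_left h]
    grind

/-- For this point of `RU` the inner sum is at least `(1/2 - 3m) + 3m = 1/2`, so the section is all
of `min t (1 - t)`, which no copula exceeds. -/
theorem integral_antidiagonalSection_eq {m : ℝ} (hm : m ∈ Icc (0 : ℝ) (1 / 6)) :
    ∫ t in (0 : ℝ)..1, antidiagonalSection m (vertexR m) t ≤
      ∫ t in (0 : ℝ)..1, antidiagonalSection m (1 / 2 - 2 * m, 1 / 2 - m) t := by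
  obtain ⟨h1, h2⟩ := hm
  refine intervalIntegral.integral_mono_on zero_le_one
    ((continuous_antidiagonalSection m _).intervalIntegrable _ _)
    ((continuous_antidiagonalSection m _).intervalIntegrable _ _) fun t ht => ?_
  obtain ⟨h3, h4⟩ := ht
  simp only [antidiagonalSection, upperForm, vertexR]
  refine le_min (min_le_left _ _) ((min_le_left _ _).trans ?_)
  grind

/-! ### The extremal points -/

/-- Exactness is tested against one reference minimizer `z₀`: under `P` nothing outside `S` does as
well, and without `P` a single tie outside `S` refutes equality. -/
theorem isMinOn_table {f : ℝ × ℝ → ℝ} {A S : Set (ℝ × ℝ)} {z₀ : ℝ × ℝ} {P : Prop}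
    (hS : S ⊆ A) (hmin : ∀ z ∈ S, ∀ w ∈ A, f z ≤ f w) (hz₀ : z₀ ∈ A)
    (hP : P → ∀ z ∈ A, f z ≤ f z₀ → z ∈ S) (hnP : ¬P → ∃ z ∈ A, z ∉ S ∧ f z ≤ f z₀)
    (h₀ : z₀ ∈ S) :
    S ⊆ {z ∈ A | IsMinOn f A z} ∧ (S = {z ∈ A | IsMinOn f A z} ↔ P) := by
  have hsub : S ⊆ {z ∈ A | IsMinOn f A z} := fun z hz =>
    ⟨hS hz, isMinOn_iff.2 (hmin z hz)⟩
  refine ⟨hsub, fun h => ?_, fun h => hsub.antisymm fun z hz =>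
    hP h z hz.1 (isMinOn_iff.1 hz.2 z₀ hz₀)⟩
  by_contra hn
  obtain ⟨z, hz, hzS, hle⟩ := hnP hn
  exact hzS (h ▸ ⟨hz, isMinOn_iff.2 fun w hw => hle.trans (hmin z₀ h₀ w hw)⟩)

theorem isMaxOn_table {f : ℝ × ℝ → ℝ} {A S : Set (ℝ × ℝ)} {z₀ : ℝ × ℝ} {P : Prop}
    (hS : S ⊆ A) (hmax : ∀ z ∈ S, ∀ w ∈ A, f w ≤ f z) (hz₀ : z₀ ∈ A)
    (hP : P → ∀ z ∈ A, f z₀ ≤ f z → z ∈ S) (hnP : ¬P → ∃ z ∈ A, z ∉ S ∧ f z₀ ≤ f z)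
    (h₀ : z₀ ∈ S) :
    S ⊆ {z ∈ A | IsMaxOn f A z} ∧ (S = {z ∈ A | IsMaxOn f A z} ↔ P) := by
  have hsub : S ⊆ {z ∈ A | IsMaxOn f A z} := fun z hz =>
    ⟨hS hz, isMaxOn_iff.2 (hmax z hz)⟩
  refine ⟨hsub, fun h => ?_, fun h => hsub.antisymm fun z hz =>
    hP h z hz.1 (isMaxOn_iff.1 hz.2 z₀ hz₀)⟩
  by_contra hn
  obtain ⟨z, hz, hzS, hle⟩ := hnP hn
  exact hzS (h ▸ ⟨hz, isMaxOn_iff.2 fun w hw => (hmax z₀ h₀ w hw).trans hle⟩)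

theorem vertexT_mem_triangle (m : ℝ) : vertexT m ∈ triangle m :=
  subset_convexHull ℝ _ (by simp)

theorem vertexR_mem_triangle (m : ℝ) : vertexR m ∈ triangle m :=
  subset_convexHull ℝ _ (by simp)

theorem vertexT_mem_minTable (m : ℝ) (κ : Kappa) : vertexT m ∈ minTable m κ := by
  cases κ <;> simp [minTable, right_mem_segment]

theorem vertexR_mem_maxTable (m : ℝ) (κ : Kappa) : vertexR m ∈ maxTable m κ := by
  cases κ <;> simp [maxTable, left_mem_segment]

theorem minTable_spec {m : ℝ} (hm : m ∈ Icc (0 : ℝ) (1 / 3)) (κ : Kappa) :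
    minTable m κ ⊆ minimizers κ m ∧ (minTable m κ = minimizers κ m ↔ m ∈ minExact κ) := by
  have hT := vertexT_mem_triangle m
  have hR := vertexR_mem_triangle m
  have tri := mem_triangle_iff hm.2
  obtain ⟨hm0, hm1⟩ := hm
  have hm : m ∈ Icc (0 : ℝ) (1 / 3) := ⟨hm0, hm1⟩
  have seg : ∀ z : ℝ × ℝ, z ∈ segment ℝ (vertexU m) (vertexT m) ↔ _ := mem_segment_UT_iff hm1
  have hT1 : (vertexT m).1 = m := rfl
  have hT2 : (vertexT m).2 = 1 - m := rfl
  -- The lowest point of `UT` at which the diagonal of the lower bound is that of `W`. For `m < 1/4`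
  -- it differs from `T` and ties with it for `φ`, `γ` and `β`.
  have hP : (1 / 2 - m, 1 / 2 + m) ∈ triangle m ∨ 1 / 4 ≤ m := by
    rcases le_total (1 / 4) m with h | h
    · exact Or.inr h
    · exact Or.inl ((tri _).2 ⟨by linarith, by linarith, by linarith⟩)
  have hPne : m < 1 / 4 → ((1 / 2 - m, 1 / 2 + m) : ℝ × ℝ) ≠ vertexT m := by
    intro h heq
    have := congrArg Prod.fst heq
    simp only [vertexT] at this
    linarith
  have hD : m < 1 / 4 → ∫ t in (0 : ℝ)..1, diagonalSection m (1 / 2 + m) t =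
      ∫ t in (0 : ℝ)..1, diagonalSection m (1 - m) t := by
    intro h
    simp only [diagonalSection_eq_copW hm0 (show m + 1 / 2 ≤ 1 / 2 + m by linarith),
      diagonalSection_eq_copW hm0 (show m + 1 / 2 ≤ 1 - m by linarith)]
  have hzero : m ∉ Ioc (0 : ℝ) (1 / 3) → m = 0 := fun h => by
    by_contra hne
    exact h ⟨lt_of_le_of_ne hm0 (Ne.symm hne), hm1⟩
  have hlt : m ∉ Icc (1 / 4 : ℝ) (1 / 3) → m < 1 / 4 := fun h => by
    by_contra hne
    exact h ⟨not_lt.1 hne, hm1⟩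
  have eqT : ∀ z ∈ triangle m, 1 - m ≤ z.2 → z = vertexT m := by
    intro z hz hb
    obtain ⟨h1, h2, h3⟩ := (tri z).1 hz
    exact Prod.ext (by rw [hT1]; linarith) (by rw [hT2]; linarith)
  have h₀ := vertexT_mem_minTable m κ
  cases κ
  · refine isMinOn_table (fun z hz => ((seg z).1 hz).1) (fun z hz w hw => ?_) hT
      (fun h z hz hle => ?_) (fun h => ?_) h₀
    · obtain ⟨hz, hab⟩ := (seg z).1 hz
      obtain ⟨h1, h2, h3⟩ := (tri w).1 hw
      simp only [eval_rho_lowerBound hm hz, eval_rho_lowerBound hm hw]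
      gcongr 6 * (m * ?_ * ?_) - 1 <;> first | linarith | exact mul_nonneg hm0 (by linarith)
    · refine (seg z).2 ⟨hz, ?_⟩
      obtain ⟨h1, h2, h3⟩ := (tri z).1 hz
      simp only [eval_rho_lowerBound hm hz, eval_rho_lowerBound hm hT] at hle
      simp only [hT1, hT2] at hle
      have := h.1
      by_contra hne
      have hlt : 0 < 1 - z.1 - z.2 := by
        rcases h3.lt_or_eq with h | h
        · linarith
        · exact absurd h hne
      -- With `s = 1 - a - b`, the two values of `ρ` differ by `6ms(s + 3m)`.
      nlinarith [mul_pos this hlt, mul_pos this (mul_pos this hlt), mul_pos this (mul_pos hlt hlt)]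
    · obtain rfl := hzero h
      refine ⟨_, hR, fun hz => ?_, ?_⟩
      · have := ((seg _).1 hz).2
        norm_num [vertexR] at this
      · simp only [eval_rho_lowerBound hm hR, eval_rho_lowerBound hm hT]
        norm_num
  · refine isMinOn_table (fun z hz => ((seg z).1 hz).1) (fun z hz w hw => ?_) hT
      (fun h z hz hle => ?_) (fun h => ?_) h₀
    · obtain ⟨hz, hab⟩ := (seg z).1 hz
      obtain ⟨h1, h2, h3⟩ := (tri w).1 hw
      simp only [eval_tau_lowerBound hm hz, eval_tau_lowerBound hm hw]
      gcongr 4 * (m * ?_) - 1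
      linarith
    · refine (seg z).2 ⟨hz, ?_⟩
      obtain ⟨h1, h2, h3⟩ := (tri z).1 hz
      simp only [eval_tau_lowerBound hm hz, eval_tau_lowerBound hm hT] at hle
      simp only [hT1, hT2] at hle
      have := h.1
      nlinarith
    · obtain rfl := hzero h
      refine ⟨_, hR, fun hz => ?_, ?_⟩
      · have := ((seg _).1 hz).2
        norm_num [vertexR] at this
      · simp only [eval_tau_lowerBound hm hR, eval_tau_lowerBound hm hT]
        norm_num
  · refine isMinOn_table (singleton_subset_iff.2 hT) (fun z hz w hw => ?_) hT
      (fun h z hz hle => ?_) (fun h => ?_) h₀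
    · obtain rfl := hz
      obtain ⟨h1, h2, h3⟩ := (tri w).1 hw
      simp only [eval_phi_lowerBound hm hT, eval_phi_lowerBound hm hw]
      simp only [hT2]
      linarith [integral_diagonalSection_antitone m (show w.2 ≤ 1 - m by linarith)]
    · refine eqT z hz ?_
      have := h.1
      simp only [eval_phi_lowerBound hm hT, eval_phi_lowerBound hm hz] at hle
      simp only [hT2] at hle
      by_contra! hb
      linarith [integral_diagonalSection_lt (by linarith) hm1 hb (by linarith)]
    · have h := hlt h
      have hP := hP.resolve_right (not_le.2 h)
      refine ⟨_, hP, hPne h, ?_⟩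
      simp only [eval_phi_lowerBound hm hP, eval_phi_lowerBound hm hT]
      simp only [hT2, hD h, le_refl]
  · refine isMinOn_table (singleton_subset_iff.2 hT) (fun z hz w hw => ?_) hT
      (fun h z hz hle => ?_) (fun h => ?_) h₀
    · obtain rfl := hz
      obtain ⟨h1, h2, h3⟩ := (tri w).1 hw
      simp only [eval_gamma_lowerBound hm hT, eval_gamma_lowerBound hm hw]
      simp only [hT1, hT2]
      nlinarith [integral_diagonalSection_antitone m (show w.2 ≤ 1 - m by linarith)]
    · refine eqT z hz ?_
      have := h.1
      obtain ⟨h1, h2, h3⟩ := (tri z).1 hz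
      simp only [eval_gamma_lowerBound hm hT, eval_gamma_lowerBound hm hz] at hle
      simp only [hT1, hT2] at hle
      by_contra! hb
      nlinarith [integral_diagonalSection_lt (by linarith) hm1 hb (by linarith)]
    · have h := hlt h
      have hP := hP.resolve_right (not_le.2 h)
      refine ⟨_, hP, hPne h, ?_⟩
      simp only [eval_gamma_lowerBound hm hP, eval_gamma_lowerBound hm hT]
      simp only [hT1, hT2, hD h]
      linarith
  · refine isMinOn_table (singleton_subset_iff.2 hT) (fun z hz w hw => ?_) hT
      (fun h z hz hle => ?_) (fun h => ?_) h₀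
    · obtain rfl := hz
      obtain ⟨h1, h2, h3⟩ := (tri w).1 hw
      simp only [eval_beta_lowerBound hm hT, eval_beta_lowerBound hm hw]
      simp only [hT2]
      grind
    · refine eqT z hz ?_
      have := h.1
      simp only [eval_beta_lowerBound hm hT, eval_beta_lowerBound hm hz] at hle
      simp only [hT2] at hle
      grind
    · have h := hlt h
      have hP := hP.resolve_right (not_le.2 h)
      refine ⟨_, hP, hPne h, ?_⟩
      simp only [eval_beta_lowerBound hm hP, eval_beta_lowerBound hm hT]
      simp only [hT2]
      grind

theorem maxTable_spec {m : ℝ} (hm : m ∈ Icc (0 : ℝ) (1 / 3)) (κ : Kappa) :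
    maxTable m κ ⊆ maximizers κ m ∧ (maxTable m κ = maximizers κ m ↔ m ∈ maxExact κ) := by
  have hT := vertexT_mem_triangle m
  have hR := vertexR_mem_triangle m
  have tri := mem_triangle_iff hm.2
  obtain ⟨hm0, hm1⟩ := hm
  have hm : m ∈ Icc (0 : ℝ) (1 / 3) := ⟨hm0, hm1⟩
  have seg : ∀ z : ℝ × ℝ, z ∈ segment ℝ (vertexR m) (vertexU m) ↔ _ := mem_segment_RU_iff hm1
  have hR1 : (vertexR m).1 = m := rfl
  have hR2 : (vertexR m).2 = 2 * m := rfl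
  have hzero : m ∉ Ioc (0 : ℝ) (1 / 3) → m = 0 := fun h => by
    by_contra hne
    exact h ⟨lt_of_le_of_ne hm0 (Ne.symm hne), hm1⟩
  have hTseg : m = 0 → vertexT m ∉ segment ℝ (vertexR m) (vertexU m) := by
    intro h hz
    have := ((seg _).1 hz).2
    simp only [vertexT, h] at this
    linarith
  -- A point of `RU` that equals `R` exactly at `m = 1/6`. Below that it ties with `R` for `γ`, by
  -- its full antidiagonal, and for `β`, since `b = 1/2 - m` gives the centre value `1/2`.
  have hQ : m < 1 / 6 → (1 / 2 - 2 * m, 1 / 2 - m) ∈ triangle m := fun h =>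
    (tri _).2 ⟨by linarith, by linarith, by linarith⟩
  have hQne : m < 1 / 6 → ((1 / 2 - 2 * m, 1 / 2 - m) : ℝ × ℝ) ∉ ({vertexR m} : Set _) := by
    intro h heq
    have := congrArg Prod.fst (mem_singleton_iff.1 heq)
    simp only [vertexR] at this
    linarith
  have eqR : ∀ z ∈ triangle m, z.2 ≤ 2 * m → z = vertexR m := by
    intro z hz hb
    obtain ⟨h1, h2, h3⟩ := (tri z).1 hz
    exact Prod.ext (by rw [hR1]; linarith) (by rw [hR2]; linarith)
  have h₀ := vertexR_mem_maxTable m κ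
  cases κ
  · refine isMaxOn_table (fun z hz => ((seg z).1 hz).1) (fun z hz w hw => ?_) hR
      (fun h z hz hle => ?_) (fun h => ?_) h₀
    · obtain ⟨hz, hab⟩ := (seg z).1 hz
      obtain ⟨h1, h2, h3⟩ := (tri w).1 hw
      simp only [eval_rho_upperBound hm hz, eval_rho_upperBound hm hw]
      gcongr 1 - 6 * (m * ?_ * ?_) <;> first | linarith | exact mul_nonneg hm0 (by linarith)
    · refine (seg z).2 ⟨hz, ?_⟩
      obtain ⟨h1, h2, h3⟩ := (tri z).1 hz
      simp only [eval_rho_upperBound hm hz, eval_rho_upperBound hm hR] at hle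
      simp only [hR1, hR2] at hle
      have := h.1
      by_contra hne
      have hlt : 0 < z.2 - z.1 - m := by
        rcases h2.lt_or_eq with h | h
        · linarith
        · exact absurd h.symm hne
      nlinarith [mul_pos this hlt, mul_pos this (mul_pos this hlt), mul_pos this (mul_pos hlt hlt)]
    · refine ⟨_, hT, hTseg (hzero h), ?_⟩
      simp only [eval_rho_upperBound hm hR, eval_rho_upperBound hm hT]
      simp [hzero h]
  · refine isMaxOn_table (fun z hz => ((seg z).1 hz).1) (fun z hz w hw => ?_) hR
      (fun h z hz hle => ?_) (fun h => ?_) h₀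
    · obtain ⟨hz, hab⟩ := (seg z).1 hz
      obtain ⟨h1, h2, h3⟩ := (tri w).1 hw
      simp only [eval_tau_upperBound hm hz, eval_tau_upperBound hm hw]
      gcongr 1 - 4 * (m * ?_)
      linarith
    · refine (seg z).2 ⟨hz, ?_⟩
      obtain ⟨h1, h2, h3⟩ := (tri z).1 hz
      simp only [eval_tau_upperBound hm hz, eval_tau_upperBound hm hR] at hle
      simp only [hR1, hR2] at hle
      have := h.1
      nlinarith
    · refine ⟨_, hT, hTseg (hzero h), ?_⟩
      simp only [eval_tau_upperBound hm hR, eval_tau_upperBound hm hT]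
      simp [hzero h]
  · refine isMaxOn_table (fun z hz => ((seg z).1 hz).1) (fun z hz w hw => ?_) hR
      (fun h z hz hle => ?_) (fun h => ?_) h₀
    · obtain ⟨hz, hab⟩ := (seg z).1 hz
      obtain ⟨h1, h2, h3⟩ := (tri w).1 hw
      simp only [eval_phi_upperBound hm hz, eval_phi_upperBound hm hw]
      gcongr 1 - 6 * (m * ?_)
      linarith
    · refine (seg z).2 ⟨hz, ?_⟩
      obtain ⟨h1, h2, h3⟩ := (tri z).1 hz
      simp only [eval_phi_upperBound hm hz, eval_phi_upperBound hm hR] at hle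
      simp only [hR1, hR2] at hle
      have := h.1
      nlinarith
    · refine ⟨_, hT, hTseg (hzero h), ?_⟩
      simp only [eval_phi_upperBound hm hR, eval_phi_upperBound hm hT]
      simp [hzero h]
  · refine isMaxOn_table (singleton_subset_iff.2 hR) (fun z hz w hw => ?_) hR
      (fun h z hz hle => ?_) (fun h => ?_) h₀
    · obtain rfl := hz
      obtain ⟨h1, h2, h3⟩ := (tri w).1 hw
      simp only [eval_gamma_upperBound hm hR, eval_gamma_upperBound hm hw]
      simp only [hR1, hR2]
      nlinarith [integral_antidiagonalSection_le hm hw]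
    · obtain ⟨h1, h2, h3⟩ := (tri z).1 hz
      simp only [eval_gamma_upperBound hm hR, eval_gamma_upperBound hm hz] at hle
      simp only [hR1, hR2] at hle
      have := h.1
      -- Both parts of `γ` are separately optimal at `R`, so a tie forces equality in the product
      -- term and puts `z` on `RU`; strictness of the integral is needed only there.
      have hb : z.2 = z.1 + m := by nlinarith [integral_antidiagonalSection_le hm hz]
      refine eqR z hz ?_
      by_contra! hlt
      have := integral_antidiagonalSection_lt h hz (by linarith) hb
      rw [hb] at hle
      linarith
    · have h : m < 1 / 6 := by
        by_contra hne
        exact h ⟨not_lt.1 hne, hm1⟩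
      refine ⟨_, hQ h, hQne h, ?_⟩
      simp only [eval_gamma_upperBound hm hR, eval_gamma_upperBound hm (hQ h)]
      simp only [hR1, hR2]
      linarith [integral_antidiagonalSection_eq ⟨hm0, h.le⟩]
  · refine isMaxOn_table (singleton_subset_iff.2 hR) (fun z hz w hw => ?_) hR
      (fun h z hz hle => ?_) (fun h => ?_) h₀
    · obtain rfl := hz
      obtain ⟨h1, h2, h3⟩ := (tri w).1 hw
      simp only [eval_beta_upperBound hm hR, eval_beta_upperBound hm hw]
      simp only [hR2]
      gcongr 4 * min _ (_ + max _ (_ - ?_)) - 1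
      linarith
    · refine eqR z hz ?_
      obtain ⟨h1, h2, h3⟩ := (tri z).1 hz
      simp only [eval_beta_upperBound hm hR, eval_beta_upperBound hm hz] at hle
      simp only [hR2] at hle
      rcases h with ⟨h4, h5⟩ | h4
      · grind
      · rw [mem_singleton_iff] at h4
        linarith
    · rcases lt_or_ge m (1 / 6) with h6 | h6
      · refine ⟨_, hQ h6, hQne h6, ?_⟩
        simp only [eval_beta_upperBound hm hR, eval_beta_upperBound hm (hQ h6)]
        simp only [hR2]
        grind
      · have h4 : 1 / 4 ≤ m := by
          by_contra! hlt
          exact h (Or.inl ⟨h6, hlt⟩)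
        have h3 : m ≠ 1 / 3 := fun heq => h (Or.inr heq)
        -- For `m ≥ 1/4` even `R` has second coordinate at least `1/2`, so its centre value is the
        -- floor `1/2 - m` and `T` does no worse; `T` and `R` coincide only at `m = 1/3`.
        refine ⟨_, hT, fun heq => ?_, ?_⟩
        · have := congrArg Prod.snd (mem_singleton_iff.1 heq)
          simp only [vertexT, vertexR] at this
          exact h3 (by linarith)
        · simp only [eval_beta_upperBound hm hR, eval_beta_upperBound hm hT]
          rw [hR2, max_eq_left (show 1 / 2 - 2 * m ≤ 0 by linarith)]
          gcongr
          exact le_max_left _ _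

end CopulaAsymmetry
end

theorem mainTheorem12 (m : ℝ) (hm : m ∈ Set.Icc (0 : ℝ) (1 / 3)) :
    -- on the triangle the local bounds are copulas
    (∀ p ∈ CopulaAsymmetry.triangle m,
      CopulaAsymmetry.IsCopula (CopulaAsymmetry.lowerBound p.1 p.2 m) ∧
      CopulaAsymmetry.IsCopula (CopulaAsymmetry.upperBound p.1 p.2 m)) ∧
    -- the maximum is attained at R and the minimum at T, for all five measures
    (∀ κ : CopulaAsymmetry.Kappa,
      CopulaAsymmetry.vertexR m ∈ CopulaAsymmetry.maximizers κ m) ∧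
    (∀ κ : CopulaAsymmetry.Kappa,
      CopulaAsymmetry.vertexT m ∈ CopulaAsymmetry.minimizers κ m) ∧
    -- the table: the listed sets consist of minimizers, respectively maximizers, and are the
    -- full sets of these exactly for the indicated values of m
    (∀ κ : CopulaAsymmetry.Kappa,
      CopulaAsymmetry.minTable m κ ⊆ CopulaAsymmetry.minimizers κ m ∧
      (CopulaAsymmetry.minTable m κ = CopulaAsymmetry.minimizers κ m ↔
        m ∈ CopulaAsymmetry.minExact κ)) ∧
    (∀ κ : CopulaAsymmetry.Kappa,
      CopulaAsymmetry.maxTable m κ ⊆ CopulaAsymmetry.maximizers κ m ∧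
      (CopulaAsymmetry.maxTable m κ = CopulaAsymmetry.maximizers κ m ↔
        m ∈ CopulaAsymmetry.maxExact κ)) := by
  refine ⟨fun p hp => ?_, fun κ => ?_, fun κ => ?_, CopulaAsymmetry.minTable_spec hm,
    CopulaAsymmetry.maxTable_spec hm⟩
  · rw [CopulaAsymmetry.lowerBound_eq_of_mem hm hp, CopulaAsymmetry.upperBound_eq_of_mem hm hp]
    exact ⟨CopulaAsymmetry.isCopula_reflectedForm (CopulaAsymmetry.admissible_lower hm hp),
      CopulaAsymmetry.isCopula_upperForm (CopulaAsymmetry.admissible_upper hm hp)⟩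
  · exact (CopulaAsymmetry.maxTable_spec hm κ).1 (CopulaAsymmetry.vertexR_mem_maxTable m κ)
  · exact (CopulaAsymmetry.minTable_spec hm κ).1 (CopulaAsymmetry.vertexT_mem_minTable m κ)
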